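/- Let $T>0$, $Q=(0,1)\times(0,T)$, and for $n\ge 1$ put $\lambda_n=(n\pi)^2$ and $e_n(x)=\sqrt2\,\sin(n\pi x)$. For real-valued $y_0,y_T\in L^2(0,1)$ set $$d_n=\int_0^1 y_T(x)e_n(x)\,dx-e^{-\lambda_nT}\int_0^1y_0(x)e_n(x)\,dx .$$ For $u\in L^2(Q)$, a weak solution of $$y_t-y_{xx}=u \text{ in } Q,\qquad y(0,t)=y(1,t)=0,\qquad y(x,0)=y_0(x)$$ is a function $y\in L^2(0,T;H_0^1(0,1))\cap C([0,T];L^2(0,1))$ with $y(\cdot,0)=y_0$ such that for every $v\in H^1_0(0,1)$ $$\frac{d}{dt}\,(y(\cdot,t),v)_{L^2(0,1)}+(y_x(\cdot,t),v')_{L^2(0,1)}=(u(\cdot,t),v)_{L^2(0,1)}$$ in the sense of distributions on $(0,T)$. Say that $u\in L^2(Q)$ steers $y_0$ to $y_T$ if there is such a weak solution with $y(\cdot,T)=y_T$. **Theorem (existence and uniqueness, hard terminal constraint).** Let $y_0\in L^2(0,1)$ and $y_T\in\mathcal A_T(y_0)$, that is, $y_T\in L^2(0,1)$ and $$\sum_{n=1}^\infty\frac{2\lambda_n}{1-e^{-2\lambda_nT}}\,|d_n|^2<\infty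 .$$ Then among all controls $u\in L^2(Q)$ that steer $y_0$ to $y_T$ there is exactly one, $u^*$, that minimizes $$J(u)=\tfrac12\|u\|_{L^2(Q)}^2 .$$ It is given by $$u^*(x,t)=\sum_{n=1}^\infty\frac{2\lambda_n\,e^{-\lambda_n(T-t)}}{1-e^{-2\lambda_nT}}\,d_n\,e_n(x),$$ where the series converges in $L^2(Q)$ and also at almost every $(x,t)\in Q$. -/

import Mathlib

open MeasureTheory Set
open scoped ContDiff

noncomputable section

namespace HeatControl

/-- Lebesgue measure on the spatial domain `(0,1)`. -/
abbrev spaceMeasure : Measure ℝ := volume.restrict (Ioo 0 1)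

/-- Lebesgue measure on the space-time cylinder `Q = (0,1) × (0,T)`;
points of `Q` are written `(x, t)`, so `p.1 = x` and `p.2 = t`. -/
abbrev cylinderMeasure (T : ℝ) : Measure (ℝ × ℝ) :=
  volume.restrict (Ioo (0 : ℝ) 1 ×ˢ Ioo (0 : ℝ) T)

/-- The real Hilbert space `L²(0,1)`. -/
abbrev L2Space : Type := Lp ℝ 2 spaceMeasure

/-- The real Hilbert space `L²(Q)`. -/
abbrev L2Q (T : ℝ) : Type := Lp ℝ 2 (cylinderMeasure T)

/-- `φ ∈ C_c^∞(a,b)`. -/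
def IsTestFunction (a b : ℝ) (φ : ℝ → ℝ) : Prop :=
  ContDiff ℝ ∞ φ ∧ HasCompactSupport φ ∧ tsupport φ ⊆ Ioo a b

/-- The Sobolev space `H₀¹(0,1)`, as the closure of `C_c^∞(0,1)` in the `H¹` norm.
An element `v` is recorded together with its weak derivative `v'`, as the pair `(v, v')`
in `L²(0,1) × L²(0,1)`; the product norm of the pair is equivalent to the `H¹` norm of `v`,
and the second component is determined by the first one. -/
def H01 : Set (L2Space × L2Space) :=
  closure {p | ∃ φ : ℝ → ℝ, IsTestFunction 0 1 φ ∧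
    p.1 =ᵐ[spaceMeasure] φ ∧ p.2 =ᵐ[spaceMeasure] deriv φ}

/-- `y` is the weak solution on `(0,T)` of `y_t - y_xx = u` in `Q`,
`y(0,t) = y(1,t) = 0`, `y(x,0) = y₀(x)`. That is: `y ∈ L²(0,T; H₀¹(0,1))`, `y` is the
representative in `C([0,T]; L²(0,1))` (so its values at `t = 0` and `t = T` are meaningful),
`y(0) = y₀`, and for every `v ∈ H₀¹(0,1)`
`d/dt (y(t), v) + (y_x(t), v') = (u(t), v)` in the sense of distributions on `(0,T)`.
Only the values of `y` on `[0,T]` matter. -/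
structure IsWeakSolution (T : ℝ) (u : L2Q T) (y₀ : L2Space) (y : ℝ → L2Space) : Prop where
  continuousOn : ContinuousOn y (Icc 0 T)
  initial : y 0 = y₀
  weak : ∃ yx : ℝ → L2Space,
    MemLp (fun t => (y t, yx t)) 2 (volume.restrict (Ioo 0 T)) ∧
    (∀ᵐ t ∂(volume.restrict (Ioo 0 T)), (y t, yx t) ∈ H01) ∧
    ∀ v ∈ H01, ∀ ψ : ℝ → ℝ, IsTestFunction 0 T ψ →
      -(∫ t in Ioo 0 T, inner ℝ (y t) v.1 * deriv ψ t)
        + (∫ t in Ioo 0 T, inner ℝ (yx t) v.2 * ψ t)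
      = ∫ p, u p * v.1 p.1 * ψ p.2 ∂(cylinderMeasure T)

/-- The control `u` steers the heat equation from `y₀` to `y(·,T) = y_T`. -/
def Steers (T : ℝ) (y₀ yT : L2Space) (u : L2Q T) : Prop :=
  ∃ y : ℝ → L2Space, IsWeakSolution T u y₀ y ∧ y T = yT

/-- The control energy `J(u) = ½ ‖u‖²_{L²(Q)}`. -/
def energy {T : ℝ} (u : L2Q T) : ℝ := (1 / 2) * ‖u‖ ^ 2

/-- `u` is a solution of the hard terminal control problem. -/
def IsMinimumEnergyControl (T : ℝ) (y₀ yT : L2Space) (u : L2Q T) : Prop :=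
  Steers T y₀ yT u ∧ ∀ w : L2Q T, Steers T y₀ yT w → energy u ≤ energy w

/-- The Dirichlet eigenfunctions `e_n(x) = √2 sin(nπx)`, `n ≥ 1`. -/
def eigenfunction (n : ℕ+) (x : ℝ) : ℝ := √2 * Real.sin (n * Real.pi * x)

/-- The Dirichlet eigenvalues `λ_n = (nπ)²`, `n ≥ 1`. -/
def eigenvalue (n : ℕ+) : ℝ := (n * Real.pi) ^ 2

/-- The Fourier coefficient `f_n = ∫₀¹ f(x) e_n(x) dx`. -/
def fourierSineCoeff (f : L2Space) (n : ℕ+) : ℝ :=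
  ∫ x, f x * eigenfunction n x ∂spaceMeasure

/-- `d_n = y_{T,n} - e^{-λ_n T} y_{0,n}`. -/
def modalGap (T : ℝ) (y₀ yT : L2Space) (n : ℕ+) : ℝ :=
  fourierSineCoeff yT n - Real.exp (-eigenvalue n * T) * fourierSineCoeff y₀ n

/-- The admissible target set `A_T(y₀)`. -/
def admissibleTargets (T : ℝ) (y₀ : L2Space) : Set L2Space :=
  {yT | Summable fun n : ℕ+ =>
    2 * eigenvalue n / (1 - Real.exp (-2 * eigenvalue n * T)) * |modalGap T y₀ yT n| ^ 2}

/-- The `n`-th term `2 λ_n e^{-λ_n (T-t)} / (1 - e^{-2 λ_n T}) d_n e_n(x)` of the control. -/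
def controlMode (T : ℝ) (y₀ yT : L2Space) (n : ℕ+) (p : ℝ × ℝ) : ℝ :=
  2 * eigenvalue n * Real.exp (-eigenvalue n * (T - p.2))
    / (1 - Real.exp (-2 * eigenvalue n * T)) * modalGap T y₀ yT n * eigenfunction n p.1

theorem memLp_controlMode (T : ℝ) (y₀ yT : L2Space) (n : ℕ+) :
    MemLp (controlMode T y₀ yT n) 2 (cylinderMeasure T) := by
  have hc : Continuous (controlMode T y₀ yT n) := by
    unfold controlMode eigenfunction
    fun_prop
  have hK : IsCompact (Icc (0 : ℝ) 1 ×ˢ Icc (0 : ℝ) T) := isCompact_Icc.prod isCompact_Icc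
  have : IsFiniteMeasure (cylinderMeasure T) := isFiniteMeasure_restrict.2
    (ne_top_of_le_ne_top hK.measure_lt_top.ne
      (measure_mono (prod_mono Ioo_subset_Icc_self Ioo_subset_Icc_self)))
  obtain ⟨C, hC⟩ := hK.exists_bound_of_continuousOn hc.continuousOn
  refine MemLp.of_bound hc.aestronglyMeasurable C ?_
  filter_upwards [ae_restrict_mem (measurableSet_Ioo.prod measurableSet_Ioo)] with p hp
  exact hC p (prod_mono Ioo_subset_Icc_self Ioo_subset_Icc_self hp)

/-- The `n`-th term of the control, as an element of `L²(Q)`. -/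
def controlModeL2 (T : ℝ) (y₀ yT : L2Space) (n : ℕ+) : L2Q T :=
  (memLp_controlMode T y₀ yT n).toLp (controlMode T y₀ yT n)

end HeatControl

end

open HeatControl

open Filter Topology

namespace HeatControl

/-! Write `φ_n = e^{-λ_n(T-t)} e_n(x)` (`adjointL2`). Testing the weak equation with `e_n` and the
integrating factor `e^{λ_n t}` shows that every steering control satisfies the moment identity `d_n
= ⟨u, φ_n⟩` (`Steers.modalGap_eq`). The `φ_n` are orthogonal in `L²(Q)` with `‖φ_n‖² = 1 / gain`
(`inner_adjointL2`), so the element of least norm with these moments is `u* = ∑ gain · d_n φ_n`, and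
admissibility says exactly that this series has finite norm.

If `w` steers, then `⟨u*, w⟩ = ∑ gain · d_n²`, a number independent of `w`. Since `u*` also steers,
`w - u*` is orthogonal to `u*` and `‖w‖² = ‖u*‖² + ‖w - u*‖²` (`norm_sq_eq_of_steers`). Minimality
and uniqueness both follow.

The main work is to show that `u*` steers. Its state is written down mode by mode (`stateCoeff`).
Completeness of the sines recovers both endpoint values, admissibility gives the bounds for
continuity in `L²` and for `L²(0,T; H₀¹)`, and the weak equation follows by summing the scalar
equations (`isWeakSolution_state`). For almost everywhere convergence, the series converges
absolutely at each `t < T`, and a subsequence argument identifies its sum with the `L²` limit. -/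

/-! ### Inner products and bounded convergence in `L²`. -/

theorem inner_eq_integral_mul {α : Type*} [MeasurableSpace α] {μ : Measure α}
    (f g : Lp ℝ 2 μ) : inner ℝ f g = ∫ x, f x * g x ∂μ := by
  rw [L2.inner_def]
  exact integral_congr_ae (.of_forall fun x => by simp [mul_comm])

theorem inner_toLp_right {α : Type*} [MeasurableSpace α] {μ : Measure α}
    (f : Lp ℝ 2 μ) {g : α → ℝ} (hg : MemLp g 2 μ) :
    inner ℝ f (hg.toLp g) = ∫ x, f x * g x ∂μ := by
  rw [inner_eq_integral_mul]
  refine integral_congr_ae ?_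
  filter_upwards [hg.coeFn_toLp] with x hx
  rw [hx]

theorem inner_toLp_toLp {α : Type*} [MeasurableSpace α] {μ : Measure α}
    {f g : α → ℝ} (hf : MemLp f 2 μ) (hg : MemLp g 2 μ) :
    inner ℝ (hf.toLp f) (hg.toLp g) = ∫ x, f x * g x ∂μ := by
  rw [inner_toLp_right]
  refine integral_congr_ae ?_
  filter_upwards [hf.coeFn_toLp] with x hx
  rw [hx]

/-- Dominated convergence applied to the squared difference, with the constant `C ^ 2` as majorant.
It serves to approximate eigenfunctions by cutoffs. -/
theorem tendsto_toLp_of_bounded {α : Type*} [MeasurableSpace α] {μ : Measure α}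
    [IsFiniteMeasure μ] {f : ℕ → α → ℝ} {g : α → ℝ} (hf : ∀ n, MemLp (f n) 2 μ)
    (hg : MemLp g 2 μ) (C : ℝ) (hC : ∀ n, ∀ᵐ x ∂μ, |f n x - g x| ≤ C)
    (hlim : ∀ᵐ x ∂μ, Tendsto (fun n => f n x) atTop (𝓝 (g x))) :
    Tendsto (fun n => (hf n).toLp (f n)) atTop (𝓝 (hg.toLp g)) := by
  rw [tendsto_iff_norm_sub_tendsto_zero]
  have key : ∀ n, ‖(hf n).toLp (f n) - hg.toLp g‖ ^ 2 = ∫ x, (f n x - g x) ^ 2 ∂μ := by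
    intro n
    rw [← MemLp.toLp_sub, ← real_inner_self_eq_norm_sq, inner_toLp_toLp]
    simp [sq]
  have h0 : Tendsto (fun n => ∫ x, (f n x - g x) ^ 2 ∂μ) atTop (𝓝 (∫ _, (0 : ℝ) ∂μ)) := by
    refine tendsto_integral_of_dominated_convergence (fun _ => C ^ 2)
      (fun n => (((hf n).1.sub hg.1).pow 2)) (integrable_const _) (fun n => ?_) ?_
    · filter_upwards [hC n] with x hx
      rw [Real.norm_eq_abs, abs_pow]
      gcongr
    · filter_upwards [hlim] with x hx
      have := (hx.sub_const (g x)).pow 2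
      simpa using this
  simp_rw [← key] at h0
  have := h0.sqrt
  simpa using this

/-! ### Sine and cosine systems; completeness of the sines. -/

theorem memLp_space_of_continuous {f : ℝ → ℝ} (hf : Continuous f) :
    MemLp f 2 spaceMeasure := by
  obtain ⟨C, hC⟩ := (isCompact_Icc (a := (0 : ℝ)) (b := 1)).exists_bound_of_continuousOn
    hf.continuousOn
  refine MemLp.of_bound hf.aestronglyMeasurable C ?_
  filter_upwards [ae_restrict_mem measurableSet_Ioo] with x hx
  exact hC x (Ioo_subset_Icc_self hx)

theorem continuous_eigenfunction (n : ℕ+) : Continuous (eigenfunction n) := by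
  unfold eigenfunction; fun_prop

/-- The Neumann eigenfunctions `√2 cos(nπx)`. -/
noncomputable def cosEigenfunction (n : ℕ+) (x : ℝ) : ℝ := √2 * Real.cos (n * Real.pi * x)

theorem continuous_cosEigenfunction (n : ℕ+) : Continuous (cosEigenfunction n) := by
  unfold cosEigenfunction; fun_prop

/-- `e_n` as an element of `L²(0,1)`. -/
noncomputable def sineL2 (n : ℕ+) : L2Space :=
  (memLp_space_of_continuous (continuous_eigenfunction n)).toLp _

/-- `√2 cos(nπx)` as an element of `L²(0,1)`. -/
noncomputable def cosineL2 (n : ℕ+) : L2Space :=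
  (memLp_space_of_continuous (continuous_cosEigenfunction n)).toLp _

theorem fourierSineCoeff_eq_inner (f : L2Space) (n : ℕ+) :
    fourierSineCoeff f n = inner ℝ f (sineL2 n) := by
  rw [sineL2, inner_toLp_right]; rfl

theorem integral_space_eq (f : ℝ → ℝ) : ∫ x, f x ∂spaceMeasure = ∫ x in (0 : ℝ)..1, f x := by
  rw [intervalIntegral.integral_of_le zero_le_one, ← integral_Ioc_eq_integral_Ioo]

theorem integral_cos_int_mul_pi (k : ℤ) :
    ∫ x in (0 : ℝ)..1, Real.cos (k * Real.pi * x) = if k = 0 then 1 else 0 := by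
  split_ifs with h
  · simp [h]
  · have : (k : ℝ) * Real.pi ≠ 0 := mul_ne_zero (by exact_mod_cast h) Real.pi_ne_zero
    rw [intervalIntegral.integral_comp_mul_left _ this]
    simp [Real.sin_int_mul_pi]

theorem orthonormal_sineL2 : Orthonormal ℝ sineL2 := by
  rw [orthonormal_iff_ite]
  intro n m
  rw [sineL2, sineL2, inner_toLp_toLp, integral_space_eq]
  have : ∀ x, eigenfunction n x * eigenfunction m x =
      Real.cos (((n - m : ℤ) : ℝ) * Real.pi * x) - Real.cos (((n + m : ℤ) : ℝ) * Real.pi * x) := by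
    intro x
    have h2 : √2 * √2 = (2 : ℝ) := Real.mul_self_sqrt (by norm_num)
    have e1 : ((n - m : ℤ) : ℝ) * Real.pi * x = n * Real.pi * x - m * Real.pi * x := by
      push_cast; ring
    have e2 : ((n + m : ℤ) : ℝ) * Real.pi * x = n * Real.pi * x + m * Real.pi * x := by
      push_cast; ring
    rw [e1, e2, Real.cos_sub, Real.cos_add, eigenfunction, eigenfunction]
    linear_combination Real.sin (n * Real.pi * x) * Real.sin (m * Real.pi * x) * h2
  simp_rw [this]
  rw [intervalIntegral.integral_sub (Continuous.intervalIntegrable (by fun_prop) _ _)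
    (Continuous.intervalIntegrable (by fun_prop) _ _), integral_cos_int_mul_pi,
    integral_cos_int_mul_pi, if_neg (show ¬ ((n : ℤ) + (m : ℤ) = 0) by have := n.pos; have := m.pos; omega), sub_zero]
  congr 1
  rw [sub_eq_zero, Nat.cast_inj, PNat.coe_inj]

theorem orthonormal_cosineL2 : Orthonormal ℝ cosineL2 := by
  rw [orthonormal_iff_ite]
  intro n m
  rw [cosineL2, cosineL2, inner_toLp_toLp, integral_space_eq]
  have : ∀ x, cosEigenfunction n x * cosEigenfunction m x =
      Real.cos (((n - m : ℤ) : ℝ) * Real.pi * x) + Real.cos (((n + m : ℤ) : ℝ) * Real.pi * x) := by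
    intro x
    have h2 : √2 * √2 = (2 : ℝ) := Real.mul_self_sqrt (by norm_num)
    have e1 : ((n - m : ℤ) : ℝ) * Real.pi * x = n * Real.pi * x - m * Real.pi * x := by
      push_cast; ring
    have e2 : ((n + m : ℤ) : ℝ) * Real.pi * x = n * Real.pi * x + m * Real.pi * x := by
      push_cast; ring
    rw [e1, e2, Real.cos_sub, Real.cos_add, cosEigenfunction, cosEigenfunction]
    linear_combination Real.cos (n * Real.pi * x) * Real.cos (m * Real.pi * x) * h2
  simp_rw [this]
  rw [intervalIntegral.integral_add (Continuous.intervalIntegrable (by fun_prop) _ _)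
    (Continuous.intervalIntegrable (by fun_prop) _ _), integral_cos_int_mul_pi,
    integral_cos_int_mul_pi, if_neg (show ¬ ((n : ℤ) + (m : ℤ) = 0) by have := n.pos; have := m.pos; omega), add_zero]
  congr 1
  rw [sub_eq_zero, Nat.cast_inj, PNat.coe_inj]

theorem integrable_mul_of_continuous (f : L2Space) {g : ℝ → ℝ} (hg : Continuous g) :
    Integrable (fun x => f x * g x) spaceMeasure :=
  (Lp.memLp f).integrable_mul (memLp_space_of_continuous hg)

/-- A function orthogonal to all `sin(nπx)` is orthogonal to all `sin(nπx) cos(πx)^k`. -/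
theorem integral_mul_sin_mul_cos_pow_eq_zero (f : L2Space)
    (h : ∀ n : ℕ, ∫ x, f x * Real.sin (n * Real.pi * x) ∂spaceMeasure = 0) (k : ℕ) :
    ∀ n : ℕ, ∫ x, f x * (Real.sin (n * Real.pi * x) * Real.cos (Real.pi * x) ^ k)
      ∂spaceMeasure = 0 := by
  induction k with
  | zero => simpa using h
  | succ k ih =>
    rintro (_ | n)
    · simp
    -- The identity `sin a cos b = (sin (a + b) + sin (a - b)) / 2` trades one cosine for the two
    -- neighbouring frequencies, so the induction hypothesis must cover every `n`, including `0`.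
    · have e : ∀ x : ℝ, f x * (Real.sin ((n + 1 : ℕ) * Real.pi * x) * Real.cos (Real.pi * x) ^ (k + 1))
          = (1 / 2) * (f x * (Real.sin ((n + 2 : ℕ) * Real.pi * x) * Real.cos (Real.pi * x) ^ k))
          + (1 / 2) * (f x * (Real.sin (n * Real.pi * x) * Real.cos (Real.pi * x) ^ k)) := by
        intro x
        have e1 : ((n + 2 : ℕ) : ℝ) * Real.pi * x = (n + 1 : ℕ) * Real.pi * x + Real.pi * x := by
          push_cast; ring
        have e2 : (n : ℝ) * Real.pi * x = (n + 1 : ℕ) * Real.pi * x - Real.pi * x := by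
          push_cast; ring
        rw [e1, e2, Real.sin_add, Real.sin_sub]
        ring
      simp_rw [e]
      rw [integral_add, integral_const_mul, integral_const_mul, ih, ih]
      · simp
      · exact (integrable_mul_of_continuous f (by fun_prop)).const_mul _
      · exact (integrable_mul_of_continuous f (by fun_prop)).const_mul _

/-- The hypothesis makes `f · sin(πx)` orthogonal to every polynomial in `cos(πx)`. As `cos(πx)`
separates the points of `[0,1]`, Stone–Weierstrass extends this to all continuous functions, so `f ·
sin(πx)` vanishes a.e.; the sine is positive on `(0,1)`. -/
theorem eq_zero_of_forall_inner_sineL2 (f : L2Space) (h : ∀ n, inner ℝ f (sineL2 n) = 0) :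
    f = 0 := by
  have hsin : ∀ n : ℕ, ∫ x, f x * Real.sin (n * Real.pi * x) ∂spaceMeasure = 0 := by
    rintro (_ | n)
    · simp
    · have := h n.succPNat
      rw [← fourierSineCoeff_eq_inner] at this
      simp only [fourierSineCoeff, eigenfunction, mul_left_comm (_ : ℝ) √2] at this
      rw [integral_const_mul] at this
      have h2 : √2 ≠ (0 : ℝ) := by positivity
      simpa [h2] using this
  have hpoly := fun k => integral_mul_sin_mul_cos_pow_eq_zero f hsin k 1
  let c : C(Icc (0 : ℝ) 1, ℝ) := ⟨fun x => Real.cos (Real.pi * x), by fun_prop⟩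
  let s : ℝ → ℝ := fun x => Real.sin (Real.pi * x)
  let A : Subalgebra ℝ C(Icc (0 : ℝ) 1, ℝ) := Algebra.adjoin ℝ {c}
  have hA : A.topologicalClosure = ⊤ := by
    refine ContinuousMap.subalgebra_topologicalClosure_eq_top_of_separatesPoints A ?_
    intro x y hxy
    refine ⟨c, ⟨c, Algebra.subset_adjoin rfl, rfl⟩, fun hc => hxy ?_⟩
    have hp := Real.pi_pos
    have := Real.injOn_cos (x₁ := Real.pi * x) (x₂ := Real.pi * y)
      ⟨mul_nonneg hp.le x.2.1, by nlinarith [x.2.2]⟩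
      ⟨mul_nonneg hp.le y.2.1, by nlinarith [y.2.2]⟩ hc
    exact Subtype.ext (mul_left_cancel₀ hp.ne' this)
  have hs : Continuous s := by fun_prop
  have hfs : Integrable (fun x => f x * s x) spaceMeasure := integrable_mul_of_continuous f hs
  -- `projIcc` extends functions on `[0,1]` to the line; on `(0,1)`, where the measure lives, it
  -- changes nothing.
  have hint : ∀ g : C(Icc (0 : ℝ) 1, ℝ), Continuous (fun x => g (projIcc 0 1 zero_le_one x)) :=
    fun g => g.continuous.comp continuous_projIcc
  have hI : ∀ g : C(Icc (0 : ℝ) 1, ℝ),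
      Integrable (fun x => f x * (s x * g (projIcc 0 1 zero_le_one x))) spaceMeasure :=
    fun g => integrable_mul_of_continuous f (hs.mul (hint g))
  let Φ : C(Icc (0 : ℝ) 1, ℝ) →ₗ[ℝ] ℝ :=
    { toFun := fun g => ∫ x, f x * (s x * g (projIcc 0 1 zero_le_one x)) ∂spaceMeasure
      map_add' := fun g₁ g₂ => by
        rw [← integral_add (hI g₁) (hI g₂)]
        congr 1; ext x; simp; ring
      map_smul' := fun a g => by
        simp only [RingHom.id_apply, smul_eq_mul]
        rw [← integral_const_mul]
        congr 1; ext x; simp; ring }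
  have hΦc : Continuous Φ := by
    refine (LinearMap.mkContinuous Φ (∫ x, ‖f x * s x‖ ∂spaceMeasure) fun g => ?_).continuous
    rw [← integral_mul_const]
    refine norm_integral_le_of_norm_le (hfs.norm.mul_const _) (.of_forall fun x => ?_)
    rw [← mul_assoc, norm_mul]
    gcongr
    exact g.norm_coe_le_norm _
  have hΦA : ∀ g ∈ A, Φ g = 0 := by
    intro g hg
    rw [show A = _ from Algebra.adjoin_singleton_eq_range_aeval ℝ c] at hg
    obtain ⟨p, rfl⟩ := hg
    change Φ (Polynomial.aeval c p) = 0
    induction p using Polynomial.induction_on' with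
    | add p q hp hq => rw [map_add, map_add, hp, hq, add_zero]
    | monomial k a =>
      have : (Polynomial.aeval c) (Polynomial.monomial k a) = a • c ^ k := by
        simp [Polynomial.aeval_monomial, Algebra.smul_def]
      rw [this, map_smul, smul_eq_zero]
      right
      refine Eq.trans (integral_congr_ae ?_) (hpoly k)
      filter_upwards [ae_restrict_mem measurableSet_Ioo] with x hx
      have : ((projIcc (0 : ℝ) 1 zero_le_one x : Icc (0 : ℝ) 1) : ℝ) = x := by
        rw [projIcc_of_mem _ (Ioo_subset_Icc_self hx)]
      simp [s, c, this]
  have hΦ : ∀ g, Φ g = 0 := by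
    intro g
    have hg : g ∈ closure (A : Set C(Icc (0 : ℝ) 1, ℝ)) := by
      rw [← Subalgebra.topologicalClosure_coe, hA]; trivial
    exact closure_minimal (s := (A : Set C(Icc (0 : ℝ) 1, ℝ))) (t := {g | Φ g = 0}) hΦA
      (isClosed_eq hΦc continuous_const) hg
  have hae : ∀ᵐ x ∂(volume : Measure ℝ), x ∈ Ioo (0 : ℝ) 1 → f x * s x = 0 := by
    refine isOpen_Ioo.ae_eq_zero_of_integral_contDiff_smul_eq_zero
      (IntegrableOn.locallyIntegrableOn hfs) fun g hg _ hgs => ?_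
    have := hΦ ⟨fun x => g x, hg.continuous.comp continuous_subtype_val⟩
    have h2 : ∫ x in Ioo (0 : ℝ) 1, g x • (f x * s x) = 0 := by
      refine Eq.trans (integral_congr_ae ?_) this
      filter_upwards [ae_restrict_mem measurableSet_Ioo] with x hx
      have : ((projIcc (0 : ℝ) 1 zero_le_one x : Icc (0 : ℝ) 1) : ℝ) = x := by
        rw [projIcc_of_mem _ (Ioo_subset_Icc_self hx)]
      simp [this]; ring
    rw [← h2, setIntegral_eq_integral_of_forall_compl_eq_zero]
    intro x hx
    rw [image_eq_zero_of_notMem_tsupport (fun h => hx (hgs h)), zero_smul]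
  rw [Lp.eq_zero_iff_ae_eq_zero]
  rw [← ae_restrict_iff' measurableSet_Ioo] at hae
  filter_upwards [hae, ae_restrict_mem measurableSet_Ioo] with x hx hx1
  have : 0 < s x := Real.sin_pos_of_pos_of_lt_pi (mul_pos Real.pi_pos hx1.1)
    (by nlinarith [hx1.2, Real.pi_pos])
  simpa [this.ne'] using hx

/-- The Hilbert basis of `L²(0,1)` made of the Dirichlet eigenfunctions. -/
noncomputable def sineBasis : HilbertBasis ℕ+ ℝ L2Space :=
  HilbertBasis.mkOfOrthogonalEqBot orthonormal_sineL2 (by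
    rw [Submodule.eq_bot_iff]
    intro f hf
    refine eq_zero_of_forall_inner_sineL2 f fun n => ?_
    exact Submodule.inner_left_of_mem_orthogonal (Submodule.subset_span (mem_range_self n)) hf)

theorem hasSum_sineBasis (f : L2Space) :
    HasSum (fun n => fourierSineCoeff f n • sineL2 n) f := by
  have := sineBasis.hasSum_repr f
  simp_rw [HilbertBasis.repr_apply_apply, sineBasis,
    HilbertBasis.coe_mkOfOrthogonalEqBot, real_inner_comm, ← fourierSineCoeff_eq_inner] at this
  exact this

/-! ### Eigenfunctions and the space `H₀¹(0,1)`. -/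

/-- The pair `(e_n, e_n')`. -/
noncomputable def sinePair (n : ℕ+) : L2Space × L2Space :=
  (sineL2 n, ((n : ℝ) * Real.pi) • cosineL2 n)

theorem hasDerivAt_eigenfunction (n : ℕ+) (x : ℝ) :
    HasDerivAt (eigenfunction n) (n * Real.pi * cosEigenfunction n x) x := by
  have h1 : HasDerivAt (fun x : ℝ => n * Real.pi * x) (n * Real.pi) x := by
    simpa using (hasDerivAt_id x).const_mul ((n : ℝ) * Real.pi)
  have := (h1.sin).const_mul √2
  convert! this using 1
  rw [cosEigenfunction]; ring

theorem hasDerivAt_cosEigenfunction (n : ℕ+) (x : ℝ) :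
    HasDerivAt (cosEigenfunction n) (-(n * Real.pi) * eigenfunction n x) x := by
  have h1 : HasDerivAt (fun x : ℝ => n * Real.pi * x) (n * Real.pi) x := by
    simpa using (hasDerivAt_id x).const_mul ((n : ℝ) * Real.pi)
  have := (h1.cos).const_mul √2
  convert! this using 1
  rw [eigenfunction]; ring

theorem contDiff_eigenfunction (n : ℕ+) : ContDiff ℝ ∞ (eigenfunction n) := by
  unfold eigenfunction
  exact contDiff_const.mul (Real.contDiff_sin.comp (contDiff_const.mul contDiff_id))

/-- The transition is constant outside `[0,1]`, so only the compact range `1 ≤ s ≤ 2` matters. With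
`s = k x (1 - x)` this bounds the derivative of a cutoff uniformly in `k`, once multiplied by a
function of size `x (1 - x)`. -/
theorem exists_abs_mul_deriv_smoothTransition_le :
    ∃ M : ℝ, ∀ s : ℝ, |s * deriv Real.smoothTransition (s - 1)| ≤ M := by
  have hd : Continuous (deriv Real.smoothTransition) :=
    (Real.smoothTransition.contDiff (n := 1)).continuous_deriv le_rfl
  have hc : Continuous fun s : ℝ => s * deriv Real.smoothTransition (s - 1) := by fun_prop
  obtain ⟨M, hM⟩ := (isCompact_Icc (a := (1 : ℝ)) (b := 2)).exists_bound_of_continuousOn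
    hc.continuousOn
  have hM0 : 0 ≤ M := (norm_nonneg _).trans (hM 1 ⟨le_rfl, by norm_num⟩)
  refine ⟨M, fun s => ?_⟩
  rcases lt_or_ge s 1 with h | h
  · have : Real.smoothTransition =ᶠ[𝓝 (s - 1)] fun _ => 0 := by
      filter_upwards [Iio_mem_nhds (show s - 1 < 0 by linarith)] with t ht
      exact Real.smoothTransition.zero_of_nonpos (le_of_lt ht)
    rw [this.deriv_eq]; simpa using hM0
  rcases lt_or_ge 2 s with h2 | h2
  · have : Real.smoothTransition =ᶠ[𝓝 (s - 1)] fun _ => 1 := by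
      filter_upwards [Ioi_mem_nhds (show 1 < s - 1 by linarith)] with t ht
      exact Real.smoothTransition.one_of_one_le (le_of_lt ht)
    rw [this.deriv_eq]; simpa using hM0
  · exact hM s ⟨h, h2⟩

/-- The sine vanishes at both ends, which gives the bounds `nπx` and `nπ(1 - x)`; the smaller of `x`
and `1 - x` is at most `2x(1 - x)`. -/
theorem abs_sin_nat_mul_pi_le (n : ℕ) {x : ℝ} (hx : x ∈ Ioo (0 : ℝ) 1) :
    |Real.sin (n * Real.pi * x)| ≤ 2 * (n * Real.pi) * (x * (1 - x)) := by
  have h0 : 0 ≤ n * Real.pi := by positivity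
  have h1 : |Real.sin (n * Real.pi * x)| ≤ n * Real.pi * x := by
    refine (Real.abs_sin_le_abs).trans ?_
    rw [abs_of_nonneg (mul_nonneg h0 hx.1.le)]
  have h2 : |Real.sin (n * Real.pi * x)| ≤ n * Real.pi * (1 - x) := by
    have e : n * Real.pi * x = n * Real.pi - n * Real.pi * (1 - x) := by ring
    rw [e, Real.sin_sub, Real.sin_nat_mul_pi, zero_mul, zero_sub, abs_neg, abs_mul,
      show |Real.cos (n * Real.pi)| = 1 by exact_mod_cast Real.abs_cos_int_mul_pi n, one_mul]
    refine (Real.abs_sin_le_abs).trans ?_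
    rw [abs_of_nonneg (mul_nonneg h0 (by linarith [hx.2]))]
  rcases le_total x (1 / 2) with h | h
  · refine h1.trans ?_
    nlinarith [mul_nonneg h0 (mul_nonneg hx.1.le (by linarith : 0 ≤ 1 - 2 * x))]
  · refine h2.trans ?_
    nlinarith [mul_nonneg h0 (mul_nonneg (by linarith [hx.2] : 0 ≤ 1 - x)
      (by linarith : 0 ≤ 2 * x - 1))]

/-- Smooth cutoffs supported in `(0,1)`. -/
noncomputable def cutoff (k : ℕ) (x : ℝ) : ℝ := Real.smoothTransition (k * (x * (1 - x)) - 1)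

theorem contDiff_cutoff (k : ℕ) : ContDiff ℝ ∞ (cutoff k) := by
  unfold cutoff
  exact Real.smoothTransition.contDiff.comp (by fun_prop)

theorem tsupport_cutoff_subset (k : ℕ) : tsupport (cutoff k) ⊆ Ioo 0 1 := by
  have : tsupport (cutoff k) ⊆ {x | 1 ≤ k * (x * (1 - x))} := by
    refine closure_minimal (fun x hx => ?_) (isClosed_le (by fun_prop) (by fun_prop))
    by_contra h
    exact hx (Real.smoothTransition.zero_of_nonpos (by simp at h; linarith))
  intro x hx
  have h := this hx
  simp only [mem_ofPred_eq] at h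
  have hk : (0 : ℝ) ≤ k := by positivity
  have : 0 < x * (1 - x) := by
    by_contra h'
    push Not at h'
    nlinarith
  constructor
  · by_contra! h'; nlinarith
  · by_contra! h'; nlinarith

theorem hasDerivAt_cutoff (k : ℕ) (x : ℝ) :
    HasDerivAt (cutoff k)
      (deriv Real.smoothTransition (k * (x * (1 - x)) - 1) * (k * (1 - 2 * x))) x := by
  have h1 : HasDerivAt (fun x : ℝ => k * (x * (1 - x)) - 1) (k * (1 - 2 * x)) x := by
    have := (((hasDerivAt_id x).mul ((hasDerivAt_id x).const_sub 1)).const_mul (k : ℝ)).sub_const 1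
    convert! this using 1
    simp only [id]; ring
  have h2 : HasDerivAt Real.smoothTransition
      (deriv Real.smoothTransition (k * (x * (1 - x)) - 1)) (k * (x * (1 - x)) - 1) :=
    ((Real.smoothTransition.contDiff (n := 1)).differentiable one_ne_zero).differentiableAt.hasDerivAt
  exact h2.comp x h1

theorem eventually_cutoff_eventuallyEq_one {x : ℝ} (hx : x ∈ Ioo (0 : ℝ) 1) :
    ∀ᶠ k : ℕ in atTop, cutoff k =ᶠ[𝓝 x] fun _ => 1 := by
  have hp : 0 < x * (1 - x) := mul_pos hx.1 (by linarith [hx.2])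
  obtain ⟨K, hK⟩ := exists_nat_gt (2 / (x * (1 - x)))
  filter_upwards [eventually_ge_atTop K] with k hk
  have h2 : 2 < k * (x * (1 - x)) := by
    rw [div_lt_iff₀ hp] at hK
    have : (K : ℝ) ≤ k := by exact_mod_cast hk
    nlinarith
  have hc : Continuous fun x : ℝ => (k : ℝ) * (x * (1 - x)) := by fun_prop
  filter_upwards [hc.continuousAt.eventually (Ioi_mem_nhds h2)] with z hz
  exact Real.smoothTransition.one_of_one_le (by linarith)

/-- The approximants are `cutoff k · e_n`. The dangerous term of their derivative, `(cutoff k)'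
e_n`, stays bounded because `e_n` vanishes linearly at the endpoints, and at each interior point it
is eventually zero. Bounded convergence then gives both `L²` limits. -/
theorem sinePair_mem_H01 (n : ℕ+) : sinePair n ∈ H01 := by
  obtain ⟨M, hM⟩ := exists_abs_mul_deriv_smoothTransition_le
  have hM0 : 0 ≤ M := (abs_nonneg _).trans (hM 0)
  let φ : ℕ → ℝ → ℝ := fun k x => cutoff k x * eigenfunction n x
  have hφ : ∀ k, ContDiff ℝ ∞ (φ k) := fun k => (contDiff_cutoff k).mul (contDiff_eigenfunction n)
  have hφ' : ∀ k, Continuous (deriv (φ k)) := fun k => (hφ k).continuous_deriv (by simp)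
  have hts : ∀ k, tsupport (φ k) ⊆ Ioo 0 1 := fun k =>
    (tsupport_mul_subset_left).trans (tsupport_cutoff_subset k)
  have hc' : Continuous fun x => (n * Real.pi) * cosEigenfunction n x :=
    continuous_const.mul (continuous_cosEigenfunction n)
  have hcut1 : ∀ k x, |cutoff k x - 1| ≤ 1 := fun k x => by
    have h1 := Real.smoothTransition.nonneg (k * (x * (1 - x)) - 1)
    have h2 := Real.smoothTransition.le_one (k * (x * (1 - x)) - 1)
    rw [cutoff, abs_le]; constructor <;> linarith
  have hder : ∀ k x, deriv (φ k) x =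
      deriv Real.smoothTransition (k * (x * (1 - x)) - 1) * (k * (1 - 2 * x)) * eigenfunction n x
        + cutoff k x * (n * Real.pi * cosEigenfunction n x) := fun k x =>
    ((hasDerivAt_cutoff k x).mul (hasDerivAt_eigenfunction n x)).deriv
  have t1 : Tendsto (fun k => (memLp_space_of_continuous (hφ k).continuous).toLp (φ k)) atTop
      (𝓝 (sineL2 n)) := by
    refine tendsto_toLp_of_bounded _ _ √2 (fun k => .of_forall fun x => ?_) ?_
    · have : φ k x - eigenfunction n x = (cutoff k x - 1) * (√2 * Real.sin (n * Real.pi * x)) := by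
        simp only [φ, eigenfunction]; ring
      rw [this, abs_mul, abs_mul, abs_of_nonneg (Real.sqrt_nonneg 2)]
      calc _ ≤ 1 * (√2 * 1) := by
            gcongr
            · exact hcut1 k x
            · exact Real.abs_sin_le_one _
        _ = _ := by ring
    · filter_upwards [ae_restrict_mem measurableSet_Ioo] with x hx
      refine tendsto_const_nhds.congr' ?_
      filter_upwards [eventually_cutoff_eventuallyEq_one hx] with k hk
      simp [φ, hk.eq_of_nhds]
  have t2 : Tendsto (fun k => (memLp_space_of_continuous (hφ' k)).toLp (deriv (φ k))) atTop
      (𝓝 ((memLp_space_of_continuous hc').toLp _)) := by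
    refine tendsto_toLp_of_bounded _ _ (M * (2 * √2 * (n * Real.pi)) + n * Real.pi * √2)
      (fun k => ?_) ?_
    · filter_upwards [ae_restrict_mem measurableSet_Ioo] with x hx
      have hsin := abs_sin_nat_mul_pi_le n hx
      have hx0 : 0 < x * (1 - x) := mul_pos hx.1 (by linarith [hx.2])
      have e : deriv (φ k) x - n * Real.pi * cosEigenfunction n x =
          deriv Real.smoothTransition (k * (x * (1 - x)) - 1) * (k * (1 - 2 * x))
            * eigenfunction n x
          + (cutoff k x - 1) * (n * Real.pi * (√2 * Real.cos (n * Real.pi * x))) := by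
        rw [hder, cosEigenfunction]; ring
      rw [e]
      refine (abs_add_le _ _).trans (add_le_add ?_ ?_)
      · have hMk := hM (k * (x * (1 - x)))
        rw [abs_mul, abs_of_nonneg (by positivity : 0 ≤ (k : ℝ) * (x * (1 - x)))] at hMk
        have h12 : |1 - 2 * x| ≤ 1 := by rw [abs_le]; constructor <;> linarith [hx.1, hx.2]
        rw [eigenfunction, abs_mul, abs_mul, abs_mul, abs_mul, abs_of_nonneg (Real.sqrt_nonneg 2),
          Nat.abs_cast]
        calc _ ≤ |deriv Real.smoothTransition (k * (x * (1 - x)) - 1)| * (k * 1) *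
              (√2 * (2 * (n * Real.pi) * (x * (1 - x)))) := by gcongr
          _ = (k * (x * (1 - x)) * |deriv Real.smoothTransition (k * (x * (1 - x)) - 1)|)
              * (2 * √2 * (n * Real.pi)) := by ring
          _ ≤ _ := by gcongr
      · rw [abs_mul, abs_mul, abs_mul √2, abs_of_nonneg (Real.sqrt_nonneg 2),
          abs_of_nonneg (by positivity : 0 ≤ (n : ℝ) * Real.pi)]
        calc _ ≤ 1 * (n * Real.pi * (√2 * 1)) := by
              gcongr
              · exact hcut1 k x
              · exact Real.abs_cos_le_one _
          _ = _ := by ring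
    · filter_upwards [ae_restrict_mem measurableSet_Ioo] with x hx
      refine tendsto_const_nhds.congr' ?_
      filter_upwards [eventually_cutoff_eventuallyEq_one hx] with k hk
      have h0 : deriv (cutoff k) x = 0 := by rw [hk.deriv_eq]; simp
      rw [(hasDerivAt_cutoff k x).deriv] at h0
      rw [hder, h0, hk.eq_of_nhds]
      simp
  have e2 : (memLp_space_of_continuous hc').toLp _ = ((n : ℝ) * Real.pi) • cosineL2 n := by
    rw [cosineL2, ← MemLp.toLp_const_smul]; rfl
  rw [e2] at t2
  refine mem_closure_of_tendsto (t1.prodMk_nhds t2) (.of_forall fun k => ?_)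
  rw [mem_ofPred_eq]
  refine ⟨φ k, ⟨hφ k, ?_, hts k⟩, 
    (memLp_space_of_continuous (hφ k).continuous).coeFn_toLp,
    (memLp_space_of_continuous (hφ' k)).coeFn_toLp⟩
  exact HasCompactSupport.of_support_subset_isCompact isCompact_Icc
    ((subset_tsupport _).trans ((hts k).trans Ioo_subset_Icc_self))

theorem H01_add {p q : L2Space × L2Space} (hp : p ∈ H01) (hq : q ∈ H01) : p + q ∈ H01 := by
  refine map_mem_closure₂ continuous_add hp hq ?_
  rintro p ⟨φ, ⟨h1, h2, h3⟩, h4, h5⟩ q ⟨ψ, ⟨g1, g2, g3⟩, g4, g5⟩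
  refine ⟨φ + ψ, ⟨h1.add g1, h2.add g2, (tsupport_add φ ψ).trans (union_subset h3 g3)⟩, ?_, ?_⟩
  · exact (Lp.coeFn_add _ _).trans (h4.add g4)
  · refine (Lp.coeFn_add _ _).trans ?_
    filter_upwards [h5, g5] with x hx gx
    rw [deriv_add (h1.differentiable (by simp) x) (g1.differentiable (by simp) x)]
    simp [hx, gx]

theorem H01_smul (a : ℝ) {p : L2Space × L2Space} (hp : p ∈ H01) : a • p ∈ H01 := by
  refine map_mem_closure (f := fun p => a • p) (continuous_const_smul a) hp ?_
  rintro p ⟨φ, ⟨h1, h2, h3⟩, h4, h5⟩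
  have hs : tsupport (fun x => a * φ x) ⊆ tsupport φ := tsupport_mul_subset_right
  refine ⟨fun x => a * φ x, ⟨contDiff_const.mul h1, h2.mul_left, hs.trans h3⟩, ?_, ?_⟩
  · refine (Lp.coeFn_smul _ _).trans ?_
    filter_upwards [h4] with x hx
    simp [hx]
  · refine (Lp.coeFn_smul _ _).trans ?_
    filter_upwards [h5] with x hx
    simp [hx, deriv_const_mul_field]

theorem zero_mem_H01 : (0 : L2Space × L2Space) ∈ H01 := by
  simpa using H01_smul 0 (sinePair_mem_H01 1)

/-- If a series of elements of `H₀¹(0,1)` converges in `H¹`, its sum is in `H₀¹(0,1)`. -/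
theorem mem_H01_of_hasSum {ι : Type*} {f : ι → L2Space × L2Space} (hf : ∀ i, f i ∈ H01)
    {p : L2Space × L2Space} (h : HasSum f p) : p ∈ H01 := by
  refine isClosed_closure.mem_of_tendsto h (.of_forall fun s => ?_)
  exact Finset.sum_induction f (· ∈ H01) (fun _ _ => H01_add) zero_mem_H01 fun i _ => hf i

/-- For a test function this is integration by parts without boundary terms; both sides are
continuous in `p`, so the identity passes to the closure. -/
theorem inner_cosineL2_of_mem_H01 {p : L2Space × L2Space} (hp : p ∈ H01) (n : ℕ+) :
    inner ℝ p.2 (cosineL2 n) = n * Real.pi * inner ℝ p.1 (sineL2 n) := by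
  refine closure_minimal (t := {p : L2Space × L2Space |
    inner ℝ p.2 (cosineL2 n) = n * Real.pi * inner ℝ p.1 (sineL2 n)}) ?_
    (isClosed_eq (by fun_prop) (by fun_prop)) hp
  rintro p ⟨φ, ⟨h1, h2, h3⟩, h4, h5⟩
  simp only [mem_ofPred_eq, cosineL2, sineL2, inner_toLp_right]
  have e1 : ∫ x, p.2 x * cosEigenfunction n x ∂spaceMeasure
      = ∫ x in (0 : ℝ)..1, cosEigenfunction n x * deriv φ x := by
    rw [← integral_space_eq]
    refine integral_congr_ae ?_
    filter_upwards [h5] with x hx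
    rw [hx, mul_comm]
  have e2 : ∫ x, p.1 x * eigenfunction n x ∂spaceMeasure
      = ∫ x in (0 : ℝ)..1, φ x * eigenfunction n x := by
    rw [← integral_space_eq]
    refine integral_congr_ae ?_
    filter_upwards [h4] with x hx
    rw [hx]
  have z0 : φ 0 = 0 := image_eq_zero_of_notMem_tsupport fun h => lt_irrefl _ (h3 h).1
  have z1 : φ 1 = 0 := image_eq_zero_of_notMem_tsupport fun h => lt_irrefl _ (h3 h).2
  have hd : Continuous (deriv φ) := h1.continuous_deriv (by simp)
  rw [e1, e2, intervalIntegral.integral_mul_deriv_eq_deriv_mul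
    (fun x _ => hasDerivAt_cosEigenfunction n x)
    (fun x _ => (h1.differentiable (by simp) x).hasDerivAt)
    ((continuous_const.mul (continuous_eigenfunction n)).intervalIntegrable _ _)
    (hd.intervalIntegrable _ _), z0, z1, ← intervalIntegral.integral_const_mul]
  simp only [mul_zero, sub_zero, zero_sub, ← intervalIntegral.integral_neg]
  congr 1; ext x; ring

/-! ### Test functions and weak derivatives in time. -/

theorem setIntegral_Ioo_eq_intervalIntegral {T : ℝ} (hT : 0 < T) (f : ℝ → ℝ) :
    ∫ t in Ioo 0 T, f t = ∫ t in (0 : ℝ)..T, f t := by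
  rw [intervalIntegral.integral_of_le hT.le, ← integral_Ioc_eq_integral_Ioo]

theorem IsTestFunction.eq_zero_left {a b : ℝ} {φ : ℝ → ℝ} (h : IsTestFunction a b φ) : φ a = 0 :=
  image_eq_zero_of_notMem_tsupport fun h' => lt_irrefl _ (h.2.2 h').1

theorem IsTestFunction.eq_zero_right {a b : ℝ} {φ : ℝ → ℝ} (h : IsTestFunction a b φ) : φ b = 0 :=
  image_eq_zero_of_notMem_tsupport fun h' => lt_irrefl _ (h.2.2 h').2

theorem IsTestFunction.continuous_deriv {a b : ℝ} {φ : ℝ → ℝ} (h : IsTestFunction a b φ) :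
    Continuous (deriv φ) := h.1.continuous_deriv (by simp)

theorem exists_isTestFunction_integral_eq_one {T : ℝ} (hT : 0 < T) :
    ∃ ρ : ℝ → ℝ, IsTestFunction 0 T ρ ∧ ∫ t, ρ t = 1 := by
  let b : ContDiffBump (T / 2) := ⟨T / 8, T / 4, by positivity, by linarith⟩
  refine ⟨b.normed volume, ⟨b.contDiff_normed, b.hasCompactSupport_normed, ?_⟩, b.integral_normed⟩
  rw [b.tsupport_normed_eq, Real.closedBall_eq_Icc]
  exact Icc_subset_Ioo (by simp only [b]; linarith) (by simp only [b]; linarith)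

/-- A test function of integral zero is the derivative of a test function. -/
theorem isTestFunction_primitive {T : ℝ} (hT : 0 < T) {φ : ℝ → ℝ} (hφ : IsTestFunction 0 T φ)
    (h0 : ∫ t, φ t = 0) : IsTestFunction 0 T (fun t => ∫ s in (0 : ℝ)..t, φ s) := by
  -- A compact interval inside `(0,T)` containing the support: the primitive vanishes left of `a`,
  -- and right of `b` because the total integral is zero.
  obtain ⟨a, b, ha, hb, hab⟩ : ∃ a b, 0 < a ∧ b < T ∧ tsupport φ ⊆ Icc a b := by
    rcases (tsupport φ).eq_empty_or_nonempty with h | h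
    · exact ⟨T / 2, T / 2, by linarith, by linarith, by simp [h]⟩
    · obtain ⟨a, ha⟩ := IsCompact.exists_isLeast (s := tsupport φ) hφ.2.1 h
      obtain ⟨b, hb⟩ := IsCompact.exists_isGreatest (s := tsupport φ) hφ.2.1 h
      exact ⟨a, b, (hφ.2.2 ha.1).1, (hφ.2.2 hb.1).2, fun x hx => ⟨ha.2 hx, hb.2 hx⟩⟩
  have hd : ∀ t, HasDerivAt (fun t => ∫ s in (0 : ℝ)..t, φ s) (φ t) t := fun t =>
    intervalIntegral.integral_hasDerivAt_right (hφ.1.continuous.intervalIntegrable _ _)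
      (hφ.1.continuous.stronglyMeasurableAtFilter _ _) hφ.1.continuous.continuousAt
  have hs : tsupport (fun t => ∫ s in (0 : ℝ)..t, φ s) ⊆ Icc a b := by
    refine closure_minimal (fun t ht => ?_) isClosed_Icc
    by_contra hn
    refine ht ?_
    rw [mem_Icc, not_and_or, not_le, not_le] at hn
    rcases hn with hn | hn
    · refine intervalIntegral.integral_zero_ae (.of_forall fun s hs => ?_)
      refine image_eq_zero_of_notMem_tsupport fun h => ?_
      have h1 := (hab h).1
      have h2 : s ≤ max 0 t := hs.2
      have h3 : max 0 t < a := max_lt ha hn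
      linarith
    · simp only
      rw [intervalIntegral.integral_eq_integral_of_support_subset, h0]
      intro s hs
      have := hab (subset_tsupport _ hs)
      exact ⟨ha.trans_le this.1, this.2.trans hn.le⟩
  refine ⟨?_, HasCompactSupport.of_support_subset_isCompact isCompact_Icc
    ((subset_tsupport _).trans hs), hs.trans (Icc_subset_Ioo ha hb)⟩
  rw [contDiff_infty_iff_deriv]
  refine ⟨fun t => (hd t).differentiableAt, ?_⟩
  rw [show deriv (fun t => ∫ s in (0 : ℝ)..t, φ s) = φ from funext fun t => (hd t).deriv]
  exact hφ.1

/-- Du Bois-Reymond lemma for continuous functions. -/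
theorem eq_of_integral_mul_deriv_eq_zero {T : ℝ} (hT : 0 < T) {P : ℝ → ℝ}
    (hP : ContinuousOn P (Icc 0 T))
    (h : ∀ χ, IsTestFunction 0 T χ → ∫ t in (0 : ℝ)..T, P t * deriv χ t = 0) : P T = P 0 := by
  obtain ⟨ρ, hρ, hρ1⟩ := exists_isTestFunction_integral_eq_one hT
  have hii : ∀ {g : ℝ → ℝ}, Continuous g → IntervalIntegrable (fun t => P t * g t) volume 0 T :=
    fun hg => ((by rwa [uIcc_of_le hT.le] : ContinuousOn P (uIcc 0 T)).mul
      hg.continuousOn).intervalIntegrable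
  set c := ∫ t in (0 : ℝ)..T, P t * ρ t with hc
  have hPc : ContinuousOn (fun t => P t - c) (Icc 0 T) := hP.sub continuousOn_const
  have key : ∀ φ, IsTestFunction 0 T φ → ∫ t in (0 : ℝ)..T, φ t * (P t - c) = 0 := by
    intro φ hφ
    set m := ∫ t, φ t with hm
    have hm' : m = ∫ t in (0 : ℝ)..T, φ t := by
      rw [intervalIntegral.integral_eq_integral_of_support_subset]
      exact ((subset_tsupport _).trans hφ.2.2).trans Ioo_subset_Ioc_self
    have hs : tsupport (fun t => m * ρ t) ⊆ tsupport ρ := tsupport_mul_subset_right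
    -- Removing the multiple `m` of the unit-mass bump `ρ` leaves mean zero, so the result is the
    -- derivative of a test function. This makes `P` equal a.e. to its `ρ`-average `c`.
    have htest : IsTestFunction 0 T (fun t => φ t - m * ρ t) := by
      refine ⟨hφ.1.sub (contDiff_const.mul hρ.1), hφ.2.1.sub hρ.2.1.mul_left, ?_⟩
      exact (tsupport_sub φ _).trans (union_subset hφ.2.2 (hs.trans hρ.2.2))
    have hint : ∫ t, (φ t - m * ρ t) = 0 := by
      rw [integral_sub (hφ.1.continuous.integrable_of_hasCompactSupport hφ.2.1)
        ((hρ.1.continuous.integrable_of_hasCompactSupport hρ.2.1).const_mul _),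
        integral_const_mul, hρ1, ← hm]
      ring
    have h1 := h _ (isTestFunction_primitive hT htest hint)
    have hd : ∀ t, deriv (fun t => ∫ s in (0 : ℝ)..t, (φ s - m * ρ s)) t = φ t - m * ρ t :=
      fun t => (intervalIntegral.integral_hasDerivAt_right
        (htest.1.continuous.intervalIntegrable _ _)
        (htest.1.continuous.stronglyMeasurableAtFilter _ _) htest.1.continuous.continuousAt).deriv
    simp_rw [hd] at h1
    have e1 : ∀ t, P t * (φ t - m * ρ t) = P t * φ t - m * (P t * ρ t) := fun t => by ring
    simp_rw [e1] at h1
    rw [intervalIntegral.integral_sub (hii hφ.1.continuous) ((hii hρ.1.continuous).const_mul _),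
      intervalIntegral.integral_const_mul, ← hc] at h1
    have e2 : ∀ t, φ t * (P t - c) = P t * φ t - c * φ t := fun t => by ring
    simp_rw [e2]
    rw [intervalIntegral.integral_sub (hii hφ.1.continuous)
      ((hφ.1.continuous.intervalIntegrable _ _).const_mul _),
      intervalIntegral.integral_const_mul, ← hm']
    linarith
  have hae : ∀ᵐ t ∂(volume : Measure ℝ), t ∈ Ioo 0 T → P t - c = 0 := by
    refine isOpen_Ioo.ae_eq_zero_of_integral_contDiff_smul_eq_zero
      ((hPc.mono Ioo_subset_Icc_self).locallyIntegrableOn measurableSet_Ioo) fun g hg hg1 hg2 => ?_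
    rw [← key g ⟨hg, hg1, hg2⟩, ← setIntegral_Ioo_eq_intervalIntegral hT,
      setIntegral_eq_integral_of_forall_compl_eq_zero]
    · rfl
    intro x hx
    rw [image_eq_zero_of_notMem_tsupport (fun h => hx (hg2 h)), zero_mul]
  rw [← ae_restrict_iff' measurableSet_Ioo, restrict_Ioo_eq_restrict_Icc] at hae
  -- Continuity up to the boundary turns a.e. equality into equality at the endpoints, where it is
  -- needed.
  have he := Measure.eqOn_Icc_of_ae_eq volume hT.ne hae hPc continuousOn_const
  have h0 : P 0 - c = 0 := he ⟨le_rfl, hT.le⟩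
  have h1 : P T - c = 0 := he ⟨hT.le, le_rfl⟩
  linarith

/-- `F` minus the primitive of `G` has zero weak derivative. As `G` is only integrable, its
primitive is handled by integration by parts for absolutely continuous functions. -/
theorem sub_eq_integral_of_weak_deriv {T : ℝ} (hT : 0 < T) {F G : ℝ → ℝ}
    (hF : ContinuousOn F (Icc 0 T)) (hG : IntervalIntegrable G volume 0 T)
    (h : ∀ χ, IsTestFunction 0 T χ →
      -∫ t in (0 : ℝ)..T, F t * deriv χ t = ∫ t in (0 : ℝ)..T, G t * χ t) :
    F T - F 0 = ∫ t in (0 : ℝ)..T, G t := by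
  have hH := hG.absolutelyContinuousOnInterval_intervalIntegral (c := 0) (by simp)
  have hHc : ContinuousOn (fun t => ∫ s in (0 : ℝ)..t, G s) (Icc 0 T) := by
    simpa [uIcc_of_le hT.le] using hH.continuousOn
  have := eq_of_integral_mul_deriv_eq_zero hT (P := fun t => F t - ∫ s in (0 : ℝ)..t, G s)
    (hF.sub hHc) fun χ hχ => ?_
  · simp only [intervalIntegral.integral_same] at this
    linarith
  have hχc : AbsolutelyContinuousOnInterval χ 0 T :=
    (hχ.1.of_le (by simp)).contDiffOn.absolutelyContinuousOnInterval
  have hd : ∫ t in (0 : ℝ)..T, deriv (fun t => ∫ s in (0 : ℝ)..t, G s) t * χ t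
      = ∫ t in (0 : ℝ)..T, G t * χ t := by
    refine intervalIntegral.integral_congr_ae ?_
    filter_upwards [hG.ae_hasDerivAt_integral] with t ht ht'
    rw [(ht (uIoc_subset_uIcc ht') 0 (by simp)).deriv]
  have hp := hH.integral_mul_deriv_eq_deriv_mul hχc
  rw [hd, hχ.eq_zero_left, hχ.eq_zero_right] at hp
  have hii : ∀ {g : ℝ → ℝ}, ContinuousOn g (Icc 0 T) →
      IntervalIntegrable (fun t => g t * deriv χ t) volume 0 T := fun hg =>
    ((by rwa [uIcc_of_le hT.le] : ContinuousOn _ (uIcc 0 T)).mul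
      hχ.continuous_deriv.continuousOn).intervalIntegrable
  simp_rw [sub_mul]
  rw [intervalIntegral.integral_sub (hii hF) (hii hHc), hp, ← h χ hχ]
  ring

/-! ### Fubini on the cylinder and the moment identity. -/

theorem cylinderMeasure_eq_prod (T : ℝ) :
    cylinderMeasure T = spaceMeasure.prod (volume.restrict (Ioo 0 T)) := by
  rw [Measure.prod_restrict]; rfl

theorem memLp_cylinder_of_continuous (T : ℝ) {f : ℝ × ℝ → ℝ} (hc : Continuous f) :
    MemLp f 2 (cylinderMeasure T) := by
  have hK : IsCompact (Icc (0 : ℝ) 1 ×ˢ Icc (0 : ℝ) T) := isCompact_Icc.prod isCompact_Icc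
  have : IsFiniteMeasure (cylinderMeasure T) := isFiniteMeasure_restrict.2
    (ne_top_of_le_ne_top hK.measure_lt_top.ne
      (measure_mono (prod_mono Ioo_subset_Icc_self Ioo_subset_Icc_self)))
  obtain ⟨C, hC⟩ := hK.exists_bound_of_continuousOn hc.continuousOn
  refine MemLp.of_bound hc.aestronglyMeasurable C ?_
  filter_upwards [ae_restrict_mem (measurableSet_Ioo.prod measurableSet_Ioo)] with p hp
  exact hC p (prod_mono Ioo_subset_Icc_self Ioo_subset_Icc_self hp)

theorem ae_cylinder_fst {T : ℝ} {P : ℝ → Prop} (h : ∀ᵐ x ∂spaceMeasure, P x) :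
    ∀ᵐ p ∂(cylinderMeasure T), P p.1 := by
  rw [cylinderMeasure_eq_prod]
  exact Measure.quasiMeasurePreserving_fst.ae h

theorem integrable_mul_of_continuous_cylinder {T : ℝ} (u : L2Q T) {f : ℝ × ℝ → ℝ}
    (hf : Continuous f) : Integrable (fun p => u p * f p) (cylinderMeasure T) :=
  (Lp.memLp u).integrable_mul (memLp_cylinder_of_continuous T hf)

/-- Fubini, with the space variable integrated first. -/
theorem integral_cylinder {T : ℝ} {f : ℝ × ℝ → ℝ} (hf : Integrable f (cylinderMeasure T)) :
    ∫ p, f p ∂(cylinderMeasure T) = ∫ t in Ioo 0 T, ∫ x, f (x, t) ∂spaceMeasure := by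
  rw [cylinderMeasure_eq_prod] at hf ⊢
  exact integral_prod_symm f hf

theorem intervalIntegrable_integral_cylinder {T : ℝ} (hT : 0 < T) {f : ℝ × ℝ → ℝ}
    (hf : Integrable f (cylinderMeasure T)) :
    IntervalIntegrable (fun t => ∫ x, f (x, t) ∂spaceMeasure) volume 0 T := by
  rw [intervalIntegrable_iff_integrableOn_Ioo_of_le hT.le]
  rw [cylinderMeasure_eq_prod] at hf
  exact hf.integral_prod_right

/-- The adjoint mode `e^{-λ_n (T-t)} e_n(x)`. -/
noncomputable def adjointMode (T : ℝ) (n : ℕ+) (p : ℝ × ℝ) : ℝ :=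
  Real.exp (-eigenvalue n * (T - p.2)) * eigenfunction n p.1

theorem continuous_adjointMode (T : ℝ) (n : ℕ+) : Continuous (adjointMode T n) := by
  unfold adjointMode eigenfunction; fun_prop

theorem eigenvalue_pos (n : ℕ+) : 0 < eigenvalue n := by
  have : (0 : ℝ) < n := by exact_mod_cast n.pos
  unfold eigenvalue; positivity

/-- The moment identity satisfied by every control that steers `y₀` to `y_T`. -/
theorem Steers.modalGap_eq {T : ℝ} (hT : 0 < T) {y₀ yT : L2Space} {u : L2Q T}
    (h : Steers T y₀ yT u) (n : ℕ+) :
    modalGap T y₀ yT n = ∫ p, u p * adjointMode T n p ∂(cylinderMeasure T) := by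
  obtain ⟨y, ⟨hyc, hy0, yx, -, hH, hw⟩, hyT⟩ := h
  set l := eigenvalue n with hl
  let F : ℝ → ℝ := fun t => inner ℝ (y t) (sineL2 n) * Real.exp (l * t)
  let g : ℝ × ℝ → ℝ := fun p => u p * (eigenfunction n p.1 * Real.exp (l * p.2))
  have hec := continuous_eigenfunction n
  have hg : Integrable g (cylinderMeasure T) :=
    integrable_mul_of_continuous_cylinder u (by fun_prop)
  have hf : ContinuousOn (fun t => inner ℝ (y t) (sineL2 n)) (Icc 0 T) :=
    hyc.inner continuousOn_const
  have hF : ContinuousOn F (Icc 0 T) := hf.mul (by fun_prop)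
  have key := sub_eq_integral_of_weak_deriv hT hF (intervalIntegrable_integral_cylinder hT hg) ?_
  · rw [← setIntegral_Ioo_eq_intervalIntegral hT, ← integral_cylinder hg] at key
    simp only [F, hy0, hyT, ← fourierSineCoeff_eq_inner, mul_zero, Real.exp_zero, mul_one] at key
    have e : ∀ p, u p * adjointMode T n p = Real.exp (-l * T) * g p := by
      intro p
      simp only [adjointMode, g, ← hl]
      rw [show -l * (T - p.2) = -l * T + l * p.2 by ring, Real.exp_add]
      ring
    simp_rw [e]
    rw [integral_const_mul, ← key, modalGap, ← hl, mul_sub, mul_left_comm, ← Real.exp_add]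
    simp
  · intro χ hχ
    have hs : tsupport (fun t => χ t * Real.exp (l * t)) ⊆ tsupport χ := tsupport_mul_subset_left
    -- With this test function, the term `λ_n χ e^{λ_n t}` of the product rule cancels the stiffness
    -- term `⟨y_x, e_n'⟩ = λ_n ⟨y, e_n⟩`, and only the weak derivative of `F` remains.
    have hψ : IsTestFunction 0 T (fun t => χ t * Real.exp (l * t)) :=
      ⟨hχ.1.mul (by fun_prop), hχ.2.1.mul_right, hs.trans hχ.2.2⟩
    have hdψ : ∀ t, deriv (fun t => χ t * Real.exp (l * t)) t =
        deriv χ t * Real.exp (l * t) + l * (χ t * Real.exp (l * t)) := by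
      intro t
      have h1 : HasDerivAt (fun t : ℝ => Real.exp (l * t)) (Real.exp (l * t) * l) t := by
        have := ((hasDerivAt_id t).const_mul l).exp
        simpa using this
      exact ((hχ.1.differentiable (by simp) t).hasDerivAt.mul h1).deriv.trans (by ring)
    have hwe := hw _ (sinePair_mem_H01 n) _ hψ
    have e1 : ∫ t in Ioo 0 T, inner ℝ (yx t) (sinePair n).2 * (χ t * Real.exp (l * t)) =
        ∫ t in Ioo 0 T, inner ℝ (y t) (sineL2 n) * (l * (χ t * Real.exp (l * t))) := by
      refine integral_congr_ae ?_
      filter_upwards [hH] with t ht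
      have := inner_cosineL2_of_mem_H01 ht n
      simp only at this
      rw [sinePair, inner_smul_right, this, hl, eigenvalue]
      ring
    have hii : ∀ {k : ℝ → ℝ}, Continuous k →
        IntervalIntegrable (fun t => inner ℝ (y t) (sineL2 n) * k t) volume 0 T := fun hk =>
      ((by rwa [uIcc_of_le hT.le] : ContinuousOn _ (uIcc 0 T)).mul hk.continuousOn).intervalIntegrable
    have hχ' := hχ.continuous_deriv
    have hχc := hχ.1.continuous
    have e2 : -(∫ t in Ioo 0 T, inner ℝ (y t) (sinePair n).1 *
          deriv (fun t => χ t * Real.exp (l * t)) t) +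
        (∫ t in Ioo 0 T, inner ℝ (yx t) (sinePair n).2 * (χ t * Real.exp (l * t))) =
        -∫ t in (0 : ℝ)..T, F t * deriv χ t := by
      rw [e1, setIntegral_Ioo_eq_intervalIntegral hT, setIntegral_Ioo_eq_intervalIntegral hT]
      simp_rw [hdψ, mul_add]
      rw [sinePair, intervalIntegral.integral_add (hii (by fun_prop)) (hii (by fun_prop))]
      simp only [F, neg_add_rev, mul_right_comm _ (Real.exp _),
        ← mul_assoc]
      ring
    rw [← e2, hwe, ← setIntegral_Ioo_eq_intervalIntegral hT]
    have e3 : ∫ p, u p * (sinePair n).1 p.1 * (χ p.2 * Real.exp (l * p.2)) ∂(cylinderMeasure T)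
        = ∫ p, u p * (eigenfunction n p.1 * (χ p.2 * Real.exp (l * p.2))) ∂(cylinderMeasure T) := by
      refine integral_congr_ae ?_
      filter_upwards [ae_cylinder_fst (memLp_space_of_continuous hec).coeFn_toLp] with p hp
      rw [sinePair, sineL2]
      simp only
      rw [hp, mul_assoc]
    rw [e3, integral_cylinder (integrable_mul_of_continuous_cylinder u (by fun_prop))]
    congr 1; ext t
    rw [← integral_mul_const]
    congr 1; ext x
    simp only [g]; ring

/-! ### Orthogonal series and the adjoint modes in `L²(Q)`. -/

theorem summable_smul_of_orthonormal {ι E : Type*} [NormedAddCommGroup E]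
    [InnerProductSpace ℝ E] [CompleteSpace E] {v : ι → E} (hv : Orthonormal ℝ v) {x : ι → ℝ}
    (hx : Summable fun i => x i ^ 2) : Summable fun i => x i • v i := by
  have := (hv.orthogonalFamily.summable_iff_norm_sq_summable x).2 (by simpa using hx)
  simpa [LinearIsometry.toSpanSingleton_apply] using this

theorem norm_sq_tsum_smul_of_orthonormal {ι E : Type*} [NormedAddCommGroup E]
    [InnerProductSpace ℝ E] [CompleteSpace E] {v : ι → E} (hv : Orthonormal ℝ v) {x : ι → ℝ}
    (hx : Summable fun i => x i ^ 2) : ‖∑' i, x i • v i‖ ^ 2 = ∑' i, x i ^ 2 := by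
  have h1 : Tendsto (fun s => ‖∑ i ∈ s, x i • v i‖ ^ 2) atTop (𝓝 (‖∑' i, x i • v i‖ ^ 2)) :=
    ((summable_smul_of_orthonormal hv hx).hasSum.norm).pow 2
  refine tendsto_nhds_unique h1 ?_
  have h2 : ∀ s : Finset ι, ‖∑ i ∈ s, x i • v i‖ ^ 2 = ∑ i ∈ s, x i ^ 2 := fun s => by
    have := hv.orthogonalFamily.norm_sum x s
    simpa [LinearIsometry.toSpanSingleton_apply] using this
  simp_rw [h2]
  exact hx.hasSum

theorem summable_mul_of_sq {ι : Type*} {f g : ι → ℝ} (hf : Summable fun i => f i ^ 2)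
    (hg : Summable fun i => g i ^ 2) : Summable fun i => |f i| * |g i| := by
  refine .of_nonneg_of_le (fun i => by positivity) (fun i => ?_) (hf.add hg)
  rw [← sq_abs (f i), ← sq_abs (g i)]
  nlinarith [sq_nonneg (|f i| - |g i|), sq_nonneg (|f i| + |g i|), abs_nonneg (f i),
    abs_nonneg (g i)]

/-- The inverse of the eigenvalue of the controllability Gramian on the `n`-th mode. -/
noncomputable def gain (T : ℝ) (n : ℕ+) : ℝ :=
  2 * eigenvalue n / (1 - Real.exp (-2 * eigenvalue n * T))

theorem one_sub_exp_pos {T : ℝ} (hT : 0 < T) (n : ℕ+) :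
    0 < 1 - Real.exp (-2 * eigenvalue n * T) := by
  have := mul_pos (eigenvalue_pos n) hT
  rw [sub_pos, Real.exp_lt_one_iff]
  linarith

theorem gain_pos {T : ℝ} (hT : 0 < T) (n : ℕ+) : 0 < gain T n :=
  div_pos (mul_pos two_pos (eigenvalue_pos n)) (one_sub_exp_pos hT n)

theorem two_mul_eigenvalue_le_gain {T : ℝ} (hT : 0 < T) (n : ℕ+) :
    2 * eigenvalue n ≤ gain T n := by
  rw [gain, le_div_iff₀ (one_sub_exp_pos hT n)]
  have := Real.exp_pos (-2 * eigenvalue n * T)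
  nlinarith [eigenvalue_pos n]

theorem one_le_eigenvalue (n : ℕ+) : 1 ≤ eigenvalue n := by
  have h1 : (1 : ℝ) ≤ n := Nat.one_le_cast.2 n.pos
  have : 1 ≤ n * Real.pi := by nlinarith [Real.pi_gt_three]
  unfold eigenvalue; nlinarith

/-- Since `λ_n ≥ 1`, the denominators are bounded below uniformly in `n`, so the gain grows no
faster than `λ_n`. -/
theorem gain_le {T : ℝ} (hT : 0 < T) (n : ℕ+) :
    gain T n ≤ 2 * eigenvalue n / (1 - Real.exp (-2 * T)) := by
  have h : 0 < 1 - Real.exp (-2 * T) := by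
    rw [sub_pos, Real.exp_lt_one_iff]; linarith
  have := eigenvalue_pos n
  unfold gain
  gcongr
  nlinarith [one_le_eigenvalue n]

theorem controlMode_eq (T : ℝ) (y₀ yT : L2Space) (n : ℕ+) (p : ℝ × ℝ) :
    controlMode T y₀ yT n p = gain T n * modalGap T y₀ yT n * adjointMode T n p := by
  rw [controlMode, gain, adjointMode]; ring

/-- The adjoint mode as an element of `L²(Q)`. -/
noncomputable def adjointL2 (T : ℝ) (n : ℕ+) : L2Q T :=
  (memLp_cylinder_of_continuous T (continuous_adjointMode T n)).toLp _

theorem controlModeL2_eq (T : ℝ) (y₀ yT : L2Space) (n : ℕ+) :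
    controlModeL2 T y₀ yT n = (gain T n * modalGap T y₀ yT n) • adjointL2 T n := by
  rw [controlModeL2, adjointL2, ← MemLp.toLp_const_smul]
  congr 1
  ext p
  exact controlMode_eq T y₀ yT n p

theorem Steers.modalGap_eq_inner {T : ℝ} (hT : 0 < T) {y₀ yT : L2Space} {u : L2Q T}
    (h : Steers T y₀ yT u) (n : ℕ+) :
    modalGap T y₀ yT n = inner ℝ u (adjointL2 T n) := by
  rw [h.modalGap_eq hT, adjointL2, inner_toLp_right]

theorem integral_exp_sq {T : ℝ} (hT : 0 < T) (n : ℕ+) :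
    ∫ t in Ioo 0 T, Real.exp (-eigenvalue n * (T - t)) * Real.exp (-eigenvalue n * (T - t))
      = (gain T n)⁻¹ := by
  have hl := (eigenvalue_pos n).ne'
  rw [setIntegral_Ioo_eq_intervalIntegral hT]
  have hd : ∀ t : ℝ, HasDerivAt (fun t => Real.exp (-2 * eigenvalue n * (T - t)) / (2 * eigenvalue n))
      (Real.exp (-eigenvalue n * (T - t)) * Real.exp (-eigenvalue n * (T - t))) t := by
    intro t
    have h1 : HasDerivAt (fun t : ℝ => -2 * eigenvalue n * (T - t)) (2 * eigenvalue n) t := by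
      have := ((hasDerivAt_id t).const_sub T).const_mul (-2 * eigenvalue n)
      convert! this using 1; ring
    have := h1.exp.div_const (2 * eigenvalue n)
    convert! this using 1
    rw [← Real.exp_add]
    field_simp
    ring_nf
  rw [intervalIntegral.integral_eq_sub_of_hasDerivAt (fun t _ => hd t)
    (Continuous.intervalIntegrable (by fun_prop) _ _), gain]
  simp
  ring

/-- The integral factors into space and time: orthonormality of the sines removes distinct modes,
and the time factor of equal modes is `(gain T n)⁻¹`. -/
theorem inner_adjointL2 {T : ℝ} (hT : 0 < T) (n m : ℕ+) :
    inner ℝ (adjointL2 T n) (adjointL2 T m) = if n = m then (gain T n)⁻¹ else 0 := by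
  have e : ∀ p, adjointMode T n p * adjointMode T m p =
      (eigenfunction n p.1 * eigenfunction m p.1) *
      (Real.exp (-eigenvalue n * (T - p.2)) * Real.exp (-eigenvalue m * (T - p.2))) := fun p => by
    simp only [adjointMode]; ring
  rw [adjointL2, adjointL2, inner_toLp_toLp]
  simp_rw [e]
  rw [cylinderMeasure_eq_prod, integral_prod_mul (fun x => eigenfunction n x * eigenfunction m x)
    (fun t => Real.exp (-eigenvalue n * (T - t)) * Real.exp (-eigenvalue m * (T - t)))]
  have ho := (orthonormal_iff_ite.1 orthonormal_sineL2) n m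
  rw [sineL2, sineL2, inner_toLp_toLp] at ho
  rw [ho]
  split_ifs with h
  · subst h
    rw [one_mul, integral_exp_sq hT]
  · rw [zero_mul]

theorem orthonormal_normalized_adjointL2 {T : ℝ} (hT : 0 < T) :
    Orthonormal ℝ fun n => √(gain T n) • adjointL2 T n := by
  rw [orthonormal_iff_ite]
  intro n m
  rw [inner_smul_left, inner_smul_right, inner_adjointL2 hT]
  split_ifs with h
  · subst h
    have := Real.mul_self_sqrt (gain_pos hT n).le
    have h0 := (gain_pos hT n).ne'
    simp only [conj_trivial]
    rw [← mul_assoc, this, mul_inv_cancel₀ h0]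
  · simp

theorem admissible_summable {T : ℝ} {y₀ yT : L2Space} (h : yT ∈ admissibleTargets T y₀) :
    Summable fun n => gain T n * modalGap T y₀ yT n ^ 2 := by
  have : Summable fun n : ℕ+ => 2 * eigenvalue n / (1 - Real.exp (-2 * eigenvalue n * T))
    * |modalGap T y₀ yT n| ^ 2 := h
  simpa [gain] using this

theorem summable_controlModeL2 {T : ℝ} (hT : 0 < T) {y₀ yT : L2Space}
    (h : yT ∈ admissibleTargets T y₀) : Summable (controlModeL2 T y₀ yT) := by
  have := summable_smul_of_orthonormal (orthonormal_normalized_adjointL2 hT)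
    (x := fun n => √(gain T n) * modalGap T y₀ yT n) (by
      refine (admissible_summable h).congr fun n => ?_
      rw [mul_pow, Real.sq_sqrt (gain_pos hT n).le])
  refine this.congr fun n => ?_
  rw [controlModeL2_eq, smul_smul, mul_right_comm, Real.mul_self_sqrt (gain_pos hT n).le]

/-! ### Pointwise convergence of the control series. -/

theorem summable_inv_eigenvalue : Summable fun n : ℕ+ => (eigenvalue n)⁻¹ := by
  have h1 : Summable fun n : ℕ => ((n : ℝ) ^ 2)⁻¹ := Real.summable_nat_pow_inv.2 (by norm_num)
  have h2 : Summable fun n : ℕ+ => ((n : ℝ) ^ 2)⁻¹ := h1.comp_injective PNat.coe_injective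
  refine .of_nonneg_of_le (fun n => (inv_pos.2 (eigenvalue_pos n)).le) (fun n => ?_) h2
  have : (0 : ℝ) < n := by exact_mod_cast n.pos
  unfold eigenvalue
  gcongr
  nlinarith [Real.pi_gt_three]

/-- From `s² / 2 ≤ e^s` at `s = 2 λ_n t`. The decay at a positive time absorbs the growth of `λ_n`
and leaves a summable factor. -/
theorem eigenvalue_mul_exp_le (n : ℕ+) {t : ℝ} (ht : 0 < t) :
    eigenvalue n * Real.exp (-2 * eigenvalue n * t) ≤ (2 * t ^ 2)⁻¹ * (eigenvalue n)⁻¹ := by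
  have hl := eigenvalue_pos n
  have h := Real.quadratic_le_exp_of_nonneg (x := 2 * eigenvalue n * t) (by positivity)
  have h2 : 2 * (eigenvalue n * t) ^ 2 ≤ Real.exp (2 * eigenvalue n * t) := by
    nlinarith [mul_pos hl ht]
  rw [show -2 * eigenvalue n * t = -(2 * eigenvalue n * t) by ring, Real.exp_neg, ← mul_inv,
    ← div_eq_mul_inv, div_le_iff₀ (Real.exp_pos _), inv_mul_eq_div, le_div_iff₀ (by positivity)]
  nlinarith

/-- Each term splits as `(√gain · d_n) (√gain · e^{-λ_n τ}) e_n(x)`. The first factor is square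
summable by admissibility, the second because `τ = T - t > 0`, and `e_n` is bounded by `√2`. -/
theorem summable_controlMode {T : ℝ} (hT : 0 < T) {y₀ yT : L2Space}
    (h : yT ∈ admissibleTargets T y₀) {p : ℝ × ℝ} (hp : p.2 < T) :
    Summable fun n => controlMode T y₀ yT n p := by
  set τ := T - p.2 with hτ
  have hτ0 : 0 < τ := sub_pos.2 hp
  have hg : Summable fun n : ℕ+ => (√(gain T n) * Real.exp (-eigenvalue n * τ)) ^ 2 := by
    refine .of_nonneg_of_le (fun n => sq_nonneg _) (fun n => ?_)
      (summable_inv_eigenvalue.mul_left (2 / (1 - Real.exp (-2 * T)) * (2 * τ ^ 2)⁻¹))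
    have h0 : 0 < 1 - Real.exp (-2 * T) := by
      rw [sub_pos, Real.exp_lt_one_iff]; linarith
    rw [mul_pow, Real.sq_sqrt (gain_pos hT n).le, sq, ← Real.exp_add,
      show -eigenvalue n * τ + -eigenvalue n * τ = -2 * eigenvalue n * τ by ring]
    calc _ ≤ 2 * eigenvalue n / (1 - Real.exp (-2 * T)) * Real.exp (-2 * eigenvalue n * τ) := by
          gcongr; exact gain_le hT n
      _ = 2 / (1 - Real.exp (-2 * T)) * (eigenvalue n * Real.exp (-2 * eigenvalue n * τ)) := by ring
      _ ≤ 2 / (1 - Real.exp (-2 * T)) * ((2 * τ ^ 2)⁻¹ * (eigenvalue n)⁻¹) := by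
          exact mul_le_mul_of_nonneg_left (eigenvalue_mul_exp_le n hτ0) (by positivity)
      _ = _ := by ring
  have hd : Summable fun n : ℕ+ => (√(gain T n) * modalGap T y₀ yT n) ^ 2 := by
    refine (admissible_summable h).congr fun n => ?_
    rw [mul_pow, Real.sq_sqrt (gain_pos hT n).le]
  refine Summable.of_norm_bounded ((summable_mul_of_sq hd hg).mul_right √2) fun n => ?_
  have e : controlMode T y₀ yT n p = (√(gain T n) * modalGap T y₀ yT n) *
      (√(gain T n) * Real.exp (-eigenvalue n * τ)) * (√2 * Real.sin (n * Real.pi * p.1)) := by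
    rw [controlMode_eq, adjointMode, eigenfunction, ← hτ]
    nth_rewrite 1 [← Real.mul_self_sqrt (gain_pos hT n).le]
    ring
  rw [e, Real.norm_eq_abs, abs_mul, abs_mul]
  gcongr
  rw [abs_mul, abs_of_nonneg (Real.sqrt_nonneg 2)]
  exact mul_le_of_le_one_right (Real.sqrt_nonneg 2) (Real.abs_sin_le_one _)

/-- `L²` convergence gives a.e. convergence along some sequence of finite partial sums; the full
series already converges pointwise, so the two limits agree. -/
theorem ae_hasSum_controlMode {T : ℝ} (hT : 0 < T) {y₀ yT : L2Space}
    (h : yT ∈ admissibleTargets T y₀) {u : L2Q T} (hu : HasSum (controlModeL2 T y₀ yT) u) :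
    ∀ᵐ p ∂(cylinderMeasure T), HasSum (fun n : ℕ+ => controlMode T y₀ yT n p) (u p) := by
  obtain ⟨ns, hns, hlim⟩ := (tendstoInMeasure_of_tendsto_Lp hu).exists_seq_tendsto_ae'
  have hsum : ∀ᵐ p ∂(cylinderMeasure T), ∀ s : Finset ℕ+,
      (∑ n ∈ s, controlModeL2 T y₀ yT n : L2Q T) p = ∑ n ∈ s, controlMode T y₀ yT n p := by
    rw [ae_all_iff]
    intro s
    have h1 : ∀ᵐ p ∂(cylinderMeasure T), ∀ n : ℕ+,
        controlModeL2 T y₀ yT n p = controlMode T y₀ yT n p :=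
      ae_all_iff.2 fun n => (memLp_controlMode T y₀ yT n).coeFn_toLp
    filter_upwards [Lp.coeFn_fun_finsetSum s (controlModeL2 T y₀ yT), h1] with p hp hp1
    rw [hp]
    exact Finset.sum_congr rfl fun n _ => hp1 n
  filter_upwards [hlim, hsum, ae_restrict_mem (measurableSet_Ioo.prod measurableSet_Ioo)]
    with p hp1 hp2 hp3
  have hS := (summable_controlMode hT h hp3.2.2).hasSum
  simp_rw [hp2] at hp1
  rw [tendsto_nhds_unique hp1 (hS.comp hns)]
  exact hS

/-! ### The state driven by the control: continuity and `H₀¹` regularity. -/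

theorem summable_fourierSineCoeff_sq (f : L2Space) :
    Summable fun n => fourierSineCoeff f n ^ 2 := by
  refine (orthonormal_sineL2.inner_products_summable f).congr fun n => ?_
  rw [real_inner_comm, ← fourierSineCoeff_eq_inner, Real.norm_eq_abs, sq_abs]

theorem summable_eigenvalue_mul_modalGap_sq {T : ℝ} (hT : 0 < T) {y₀ yT : L2Space}
    (h : yT ∈ admissibleTargets T y₀) :
    Summable fun n => eigenvalue n * modalGap T y₀ yT n ^ 2 := by
  refine .of_nonneg_of_le (fun n => mul_nonneg (eigenvalue_pos n).le (sq_nonneg _)) (fun n => ?_)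
    (admissible_summable h)
  gcongr
  linarith [two_mul_eigenvalue_le_gain hT n, eigenvalue_pos n]

theorem summable_modalGap_sq {T : ℝ} (hT : 0 < T) {y₀ yT : L2Space}
    (h : yT ∈ admissibleTargets T y₀) : Summable fun n => modalGap T y₀ yT n ^ 2 := by
  refine .of_nonneg_of_le (fun n => sq_nonneg _) (fun n => ?_)
    (summable_eigenvalue_mul_modalGap_sq hT h)
  exact le_mul_of_one_le_left (sq_nonneg _) (one_le_eigenvalue n)

/-- The `n`-th Fourier coefficient of the optimal state at time `t`. -/
noncomputable def stateCoeff (T : ℝ) (y₀ yT : L2Space) (n : ℕ+) (t : ℝ) : ℝ :=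
  Real.exp (-eigenvalue n * t) * fourierSineCoeff y₀ n +
    modalGap T y₀ yT n * ((Real.exp (-eigenvalue n * (T - t)) - Real.exp (-eigenvalue n * (T + t)))
      / (1 - Real.exp (-2 * eigenvalue n * T)))

/-- The optimal state `y(t)`. -/
noncomputable def state (T : ℝ) (y₀ yT : L2Space) (t : ℝ) : L2Space :=
  ∑' n, stateCoeff T y₀ yT n t • sineL2 n

/-- The weak space derivative of the optimal state. -/
noncomputable def stateDeriv (T : ℝ) (y₀ yT : L2Space) (t : ℝ) : L2Space :=
  ∑' n : ℕ+, (stateCoeff T y₀ yT n t * (n * Real.pi)) • cosineL2 n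

section

variable {T : ℝ} {y₀ yT : L2Space}

theorem continuous_stateCoeff (n : ℕ+) : Continuous (stateCoeff T y₀ yT n) := by
  unfold stateCoeff; fun_prop

/-- The modal equation `y_n' + λ_n y_n = u_n`; `stateCoeff` is its Duhamel solution with the time
integral evaluated. -/
theorem hasDerivAt_stateCoeff (hT : 0 < T) (n : ℕ+) (t : ℝ) :
    HasDerivAt (stateCoeff T y₀ yT n) (-eigenvalue n * stateCoeff T y₀ yT n t +
      gain T n * modalGap T y₀ yT n * Real.exp (-eigenvalue n * (T - t))) t := by
  have h1 : HasDerivAt (fun t : ℝ => -eigenvalue n * t) (-eigenvalue n) t := by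
    simpa using (hasDerivAt_id t).const_mul (-eigenvalue n)
  have h2 : HasDerivAt (fun t : ℝ => -eigenvalue n * (T - t)) (eigenvalue n) t := by
    have := ((hasDerivAt_id t).const_sub T).const_mul (-eigenvalue n)
    convert! this using 1; ring
  have h3 : HasDerivAt (fun t : ℝ => -eigenvalue n * (T + t)) (-eigenvalue n) t := by
    have := ((hasDerivAt_id t).const_add T).const_mul (-eigenvalue n)
    convert! this using 1; ring
  have := (h1.exp.mul_const (fourierSineCoeff y₀ n)).add
    (((h2.exp.sub h3.exp).div_const (1 - Real.exp (-2 * eigenvalue n * T))).const_mul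
      (modalGap T y₀ yT n))
  convert! this using 1
  rw [stateCoeff, gain]
  have := (one_sub_exp_pos hT n).ne'
  field_simp
  ring

theorem stateCoeff_zero (n : ℕ+) : stateCoeff T y₀ yT n 0 = fourierSineCoeff y₀ n := by
  simp [stateCoeff]

theorem stateCoeff_terminal (hT : 0 < T) (n : ℕ+) :
    stateCoeff T y₀ yT n T = fourierSineCoeff yT n := by
  have := (one_sub_exp_pos hT n).ne'
  rw [stateCoeff, sub_self, mul_zero, Real.exp_zero,
    show -eigenvalue n * (T + T) = -2 * eigenvalue n * T by ring, div_self this, modalGap]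
  ring

theorem abs_stateCoeff_le (hT : 0 < T) (n : ℕ+) {t : ℝ} (ht : t ∈ Icc 0 T) :
    |stateCoeff T y₀ yT n t| ≤
      Real.exp (-eigenvalue n * t) * |fourierSineCoeff y₀ n| + |modalGap T y₀ yT n| := by
  have hD := one_sub_exp_pos hT n
  have hl := eigenvalue_pos n
  have e : Real.exp (-2 * eigenvalue n * T) =
      Real.exp (-eigenvalue n * (T - t)) * Real.exp (-eigenvalue n * (T + t)) := by
    rw [← Real.exp_add]; ring_nf
  have hA : Real.exp (-eigenvalue n * (T - t)) ≤ 1 := by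
    rw [Real.exp_le_one_iff]; nlinarith [ht.2]
  have hB : Real.exp (-eigenvalue n * (T + t)) ≤ Real.exp (-eigenvalue n * (T - t)) := by
    rw [Real.exp_le_exp]; nlinarith [ht.1]
  have hB0 := Real.exp_pos (-eigenvalue n * (T + t))
  have h1 : |(Real.exp (-eigenvalue n * (T - t)) - Real.exp (-eigenvalue n * (T + t)))
      / (1 - Real.exp (-2 * eigenvalue n * T))| ≤ 1 := by
    rw [abs_of_nonneg (div_nonneg (sub_nonneg.2 hB) hD.le), div_le_one hD, e]
    -- With `A`, `B` the two exponentials, `A - B ≤ 1 - A B` is `(1 - A)(1 + B) ≥ 0`.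
    nlinarith
  refine (abs_add_le _ _).trans ?_
  rw [abs_mul, abs_mul, abs_of_pos (Real.exp_pos _)]
  gcongr
  exact mul_le_of_le_one_right (abs_nonneg _) h1

theorem abs_stateCoeff_le_add (hT : 0 < T) (n : ℕ+) {t : ℝ} (ht : t ∈ Icc 0 T) :
    |stateCoeff T y₀ yT n t| ≤ |fourierSineCoeff y₀ n| + |modalGap T y₀ yT n| := by
  refine (abs_stateCoeff_le hT n ht).trans ?_
  gcongr
  refine mul_le_of_le_one_left (abs_nonneg _) ?_
  rw [Real.exp_le_one_iff]
  nlinarith [ht.1, eigenvalue_pos n]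

theorem summable_coeff_bound_sq (hT : 0 < T) (h : yT ∈ admissibleTargets T y₀) :
    Summable fun n => (|fourierSineCoeff y₀ n| + |modalGap T y₀ yT n|) ^ 2 := by
  refine .of_nonneg_of_le (fun n => sq_nonneg _) (fun n => ?_)
    (((summable_fourierSineCoeff_sq y₀).mul_left 2).add ((summable_modalGap_sq hT h).mul_left 2))
  rw [← sq_abs (fourierSineCoeff y₀ n), ← sq_abs (modalGap T y₀ yT n)]
  nlinarith [sq_nonneg (|fourierSineCoeff y₀ n| - |modalGap T y₀ yT n|)]

theorem summable_stateCoeff_sq (hT : 0 < T) (h : yT ∈ admissibleTargets T y₀) {t : ℝ}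
    (ht : t ∈ Icc 0 T) : Summable fun n => stateCoeff T y₀ yT n t ^ 2 := by
  refine .of_nonneg_of_le (fun n => sq_nonneg _) (fun n => ?_) (summable_coeff_bound_sq hT h)
  rw [← sq_abs]
  gcongr
  exact abs_stateCoeff_le_add hT n ht

theorem hasSum_state (hT : 0 < T) (h : yT ∈ admissibleTargets T y₀) {t : ℝ}
    (ht : t ∈ Icc 0 T) :
    HasSum (fun n => stateCoeff T y₀ yT n t • sineL2 n) (state T y₀ yT t) :=
  (summable_smul_of_orthonormal orthonormal_sineL2 (summable_stateCoeff_sq hT h ht)).hasSum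

theorem state_zero : state T y₀ yT 0 = y₀ := by
  simp_rw [state, stateCoeff_zero]
  exact (hasSum_sineBasis y₀).tsum_eq

theorem state_terminal (hT : 0 < T) : state T y₀ yT T = yT := by
  simp_rw [state, stateCoeff_terminal hT]
  exact (hasSum_sineBasis yT).tsum_eq

/-- By Parseval the squared distance is a series of squared coefficient differences. Each term tends
to zero, and a summable majorant independent of `t` allows the limit under the sum. -/
theorem continuousOn_state (hT : 0 < T) (h : yT ∈ admissibleTargets T y₀) :
    ContinuousOn (state T y₀ yT) (Icc 0 T) := by
  intro s hs
  rw [ContinuousWithinAt, tendsto_iff_norm_sub_tendsto_zero]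
  have hbd : ∀ t ∈ Icc 0 T, ∀ n, (stateCoeff T y₀ yT n t - stateCoeff T y₀ yT n s) ^ 2 ≤
      4 * (|fourierSineCoeff y₀ n| + |modalGap T y₀ yT n|) ^ 2 := by
    intro t ht n
    have h1 := abs_stateCoeff_le_add (y₀ := y₀) (yT := yT) hT n ht
    have h2 := abs_stateCoeff_le_add (y₀ := y₀) (yT := yT) hT n hs
    have h3 := (abs_sub (stateCoeff T y₀ yT n t) (stateCoeff T y₀ yT n s)).trans (add_le_add h1 h2)
    rw [← sq_abs]
    nlinarith [abs_nonneg (stateCoeff T y₀ yT n t - stateCoeff T y₀ yT n s)]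
  have hsumm := (summable_coeff_bound_sq hT h).mul_left 4
  have e : ∀ t ∈ Icc 0 T, ‖state T y₀ yT t - state T y₀ yT s‖ ^ 2 =
      ∑' n, (stateCoeff T y₀ yT n t - stateCoeff T y₀ yT n s) ^ 2 := by
    intro t ht
    rw [← norm_sq_tsum_smul_of_orthonormal orthonormal_sineL2
      (.of_nonneg_of_le (fun n => sq_nonneg _) (hbd t ht) hsumm),
      ← ((hasSum_state hT h ht).sub (hasSum_state hT h hs)).tsum_eq]
    simp_rw [sub_smul]
  have h0 : Tendsto (fun t => ∑' n, (stateCoeff T y₀ yT n t - stateCoeff T y₀ yT n s) ^ 2)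
      (𝓝[Icc 0 T] s) (𝓝 (∑' _ : ℕ+, (0 : ℝ))) := by
    refine tendsto_tsum_of_dominated_convergence hsumm (fun n => ?_) ?_
    · have : Continuous fun t => (stateCoeff T y₀ yT n t - stateCoeff T y₀ yT n s) ^ 2 :=
        ((continuous_stateCoeff n).sub continuous_const).pow 2
      simpa using (this.tendsto s).mono_left nhdsWithin_le_nhds
    · filter_upwards [self_mem_nhdsWithin] with t ht n
      rw [Real.norm_of_nonneg (sq_nonneg _)]
      exact hbd t ht n
  rw [tsum_zero] at h0
  have h1 : Tendsto (fun t => ‖state T y₀ yT t - state T y₀ yT s‖ ^ 2) (𝓝[Icc 0 T] s) (𝓝 0) := by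
    refine h0.congr' ?_
    filter_upwards [self_mem_nhdsWithin] with t ht
    exact (e t ht).symm
  simpa using h1.sqrt

theorem stateCoeff_mul_pi_sq_le (hT : 0 < T) (n : ℕ+) {t : ℝ} (ht : t ∈ Icc 0 T) :
    (stateCoeff T y₀ yT n t * (n * Real.pi)) ^ 2 ≤
      2 * eigenvalue n * Real.exp (-2 * eigenvalue n * t) * fourierSineCoeff y₀ n ^ 2 +
      2 * (eigenvalue n * modalGap T y₀ yT n ^ 2) := by
  have h := abs_stateCoeff_le (y₀ := y₀) (yT := yT) hT n ht
  have e : Real.exp (-2 * eigenvalue n * t) = Real.exp (-eigenvalue n * t) ^ 2 := by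
    rw [sq, ← Real.exp_add]; ring_nf
  have h2 : stateCoeff T y₀ yT n t ^ 2 ≤
      2 * (Real.exp (-eigenvalue n * t) * |fourierSineCoeff y₀ n|) ^ 2
        + 2 * |modalGap T y₀ yT n| ^ 2 := by
    rw [← sq_abs (stateCoeff T y₀ yT n t)]
    refine (pow_le_pow_left₀ (abs_nonneg _) h 2).trans ?_
    nlinarith [sq_nonneg (Real.exp (-eigenvalue n * t) * |fourierSineCoeff y₀ n| -
      |modalGap T y₀ yT n|)]
  rw [mul_pow, ← eigenvalue, e]
  rw [mul_pow, sq_abs, sq_abs] at h2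
  nlinarith [mul_le_mul_of_nonneg_right h2 (eigenvalue_pos n).le]

/-- The time must be positive for the `y₀` part, since `λ_n y_{0,n}²` need not be summable for `y₀`
merely in `L²`; the gap part is summable by admissibility. -/
theorem summable_stateCoeff_mul_pi_sq (hT : 0 < T) (h : yT ∈ admissibleTargets T y₀) {t : ℝ}
    (ht : t ∈ Ioo 0 T) : Summable fun n : ℕ+ => (stateCoeff T y₀ yT n t * (n * Real.pi)) ^ 2 := by
  refine .of_nonneg_of_le (fun n => sq_nonneg _)
    (fun n => stateCoeff_mul_pi_sq_le hT n (Ioo_subset_Icc_self ht)) ?_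
  refine .add ?_ ((summable_eigenvalue_mul_modalGap_sq hT h).mul_left 2)
  refine .of_nonneg_of_le (fun n => by have := eigenvalue_pos n; positivity) (fun n => ?_)
    ((summable_fourierSineCoeff_sq y₀).mul_left (2 * (2 * t ^ 2)⁻¹))
  have h1 := eigenvalue_mul_exp_le n ht.1
  have ht2 : 0 < (2 * t ^ 2)⁻¹ := by have := ht.1; positivity
  have h2 : (2 * t ^ 2)⁻¹ * (eigenvalue n)⁻¹ ≤ (2 * t ^ 2)⁻¹ :=
    mul_le_of_le_one_right ht2.le (inv_le_one_of_one_le₀ (one_le_eigenvalue n))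
  rw [mul_assoc 2]
  gcongr
  exact h1.trans h2

theorem hasSum_stateDeriv (hT : 0 < T) (h : yT ∈ admissibleTargets T y₀) {t : ℝ}
    (ht : t ∈ Ioo 0 T) :
    HasSum (fun n : ℕ+ => (stateCoeff T y₀ yT n t * (n * Real.pi)) • cosineL2 n)
      (stateDeriv T y₀ yT t) :=
  (summable_smul_of_orthonormal orthonormal_cosineL2
    (summable_stateCoeff_mul_pi_sq hT h ht)).hasSum

theorem state_mem_H01 (hT : 0 < T) (h : yT ∈ admissibleTargets T y₀) {t : ℝ}
    (ht : t ∈ Ioo 0 T) : (state T y₀ yT t, stateDeriv T y₀ yT t) ∈ H01 := by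
  have hs := (hasSum_state hT h (Ioo_subset_Icc_self ht)).prodMk (hasSum_stateDeriv hT h ht)
  refine mem_H01_of_hasSum (fun n => ?_) hs
  rw [mul_smul]
  exact H01_smul (stateCoeff T y₀ yT n t) (sinePair_mem_H01 n)

theorem integral_exp_le {l : ℝ} (hl : 0 < l) (hT : 0 < T) :
    ∫ t in Ioo 0 T, Real.exp (-l * t) ≤ l⁻¹ := by
  rw [setIntegral_Ioo_eq_intervalIntegral hT,
    intervalIntegral.integral_comp_mul_left (fun x => Real.exp x) (by linarith : -l ≠ 0)]
  simp only [integral_exp, mul_zero, Real.exp_zero, smul_eq_mul]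
  rw [inv_neg, neg_mul_comm, neg_sub]
  refine mul_le_of_le_one_right (inv_pos.2 hl).le ?_
  linarith [Real.exp_pos (-l * T)]

theorem integrableOn_Ioo_of_continuous {f : ℝ → ℝ} (hf : Continuous f) :
    IntegrableOn f (Ioo 0 T) :=
  (hf.continuousOn.integrableOn_compact isCompact_Icc).mono_set Ioo_subset_Icc_self

/-- Parseval and Tonelli reduce the norm to a sum of modal integrals. The blow-up at `t = 0` is
harmless because `∫ 2 λ_n e^{-2 λ_n t} dt ≤ 1`, which leaves `∑ y_{0,n}²` plus the admissible sum.
-/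
theorem memLp_stateDeriv (hT : 0 < T) (h : yT ∈ admissibleTargets T y₀) :
    MemLp (stateDeriv T y₀ yT) 2 (volume.restrict (Ioo 0 T)) := by
  have hm : AEStronglyMeasurable (stateDeriv T y₀ yT) (volume.restrict (Ioo 0 T)) := by
    refine aestronglyMeasurable_of_tendsto_ae (atTop : Filter (Finset ℕ+))
      (f := fun s t => ∑ n ∈ s, (stateCoeff T y₀ yT n t * (n * Real.pi)) • cosineL2 n)
      (fun s => ?_) ?_
    · refine Continuous.aestronglyMeasurable (continuous_finsetSum _ fun n _ => ?_)
      exact ((continuous_stateCoeff n).mul continuous_const).smul continuous_const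
    · filter_upwards [ae_restrict_mem measurableSet_Ioo] with t ht
      exact hasSum_stateDeriv hT h ht
  rw [memLp_two_iff_integrable_sq_norm hm]
  refine ⟨hm.norm.pow 2, ?_⟩
  rw [hasFiniteIntegral_iff_ofReal (.of_forall fun t => sq_nonneg _)]
  have e : ∫⁻ t in Ioo 0 T, ENNReal.ofReal (‖stateDeriv T y₀ yT t‖ ^ 2) =
      ∑' n : ℕ+, ∫⁻ t in Ioo 0 T,
        ENNReal.ofReal ((stateCoeff T y₀ yT n t * (n * Real.pi)) ^ 2) := by
    rw [← lintegral_tsum fun n => ?_]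
    · refine lintegral_congr_ae ?_
      filter_upwards [ae_restrict_mem measurableSet_Ioo] with t ht
      have hs := summable_stateCoeff_mul_pi_sq hT h ht
      rw [stateDeriv, norm_sq_tsum_smul_of_orthonormal orthonormal_cosineL2 hs,
        ENNReal.ofReal_tsum_of_nonneg (fun n => sq_nonneg _) hs]
    · exact (ENNReal.continuous_ofReal.comp
        (((continuous_stateCoeff n).mul continuous_const).pow 2)).measurable.aemeasurable
  rw [e]
  have hsumm : Summable fun n => fourierSineCoeff y₀ n ^ 2 +
      T * (2 * (eigenvalue n * modalGap T y₀ yT n ^ 2)) :=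
    (summable_fourierSineCoeff_sq y₀).add
      (((summable_eigenvalue_mul_modalGap_sq hT h).mul_left 2).mul_left T)
  refine lt_of_le_of_lt (ENNReal.tsum_le_tsum fun n => ?_) hsumm.tsum_ofReal_lt_top
  have hl := eigenvalue_pos n
  have hc1 : Continuous fun t : ℝ =>
      2 * eigenvalue n * Real.exp (-2 * eigenvalue n * t) * fourierSineCoeff y₀ n ^ 2 := by fun_prop
  have hc2 : Continuous fun t : ℝ => (stateCoeff T y₀ yT n t * (n * Real.pi)) ^ 2 :=
    ((continuous_stateCoeff n).mul continuous_const).pow 2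
  rw [← ofReal_integral_eq_lintegral_ofReal (integrableOn_Ioo_of_continuous hc2)
    (.of_forall fun t => sq_nonneg _)]
  refine ENNReal.ofReal_le_ofReal ?_
  have hle : ∫ t in Ioo 0 T, (stateCoeff T y₀ yT n t * (n * Real.pi)) ^ 2 ≤
      ∫ t in Ioo 0 T, (2 * eigenvalue n * Real.exp (-2 * eigenvalue n * t) *
        fourierSineCoeff y₀ n ^ 2 + 2 * (eigenvalue n * modalGap T y₀ yT n ^ 2)) :=
    setIntegral_mono_on (integrableOn_Ioo_of_continuous hc2)
      (integrableOn_Ioo_of_continuous (hc1.add continuous_const)) measurableSet_Ioo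
      fun t ht => stateCoeff_mul_pi_sq_le hT n (Ioo_subset_Icc_self ht)
  refine hle.trans ?_
  rw [integral_add (integrableOn_Ioo_of_continuous hc1)
    (integrableOn_Ioo_of_continuous continuous_const), integral_mul_const, integral_const_mul]
  have h1 := integral_exp_le (l := 2 * eigenvalue n) (by positivity) hT
  rw [← neg_mul] at h1
  gcongr ?_ + ?_
  · refine mul_le_of_le_one_left (sq_nonneg _) ?_
    calc _ ≤ 2 * eigenvalue n * (2 * eigenvalue n)⁻¹ := by gcongr
      _ = 1 := mul_inv_cancel₀ (by positivity)
  · simp [hT.le]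

theorem memLp_state_pair (hT : 0 < T) (h : yT ∈ admissibleTargets T y₀) :
    MemLp (fun t => (state T y₀ yT t, stateDeriv T y₀ yT t)) 2 (volume.restrict (Ioo 0 T)) := by
  refine MemLp.of_fst_snd ⟨?_, memLp_stateDeriv hT h⟩
  have hc := continuousOn_state hT h
  obtain ⟨C, hC⟩ := isCompact_Icc.exists_bound_of_continuousOn hc
  refine MemLp.of_bound ((hc.mono Ioo_subset_Icc_self).aestronglyMeasurable measurableSet_Ioo) C ?_
  filter_upwards [ae_restrict_mem measurableSet_Ioo] with t ht
  exact hC t (Ioo_subset_Icc_self ht)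

/-! ### Termwise verification of the weak equation. -/

/-- The weak form of the ordinary differential equation of a single mode. -/
theorem stateCoeff_weak (hT : 0 < T) (n : ℕ+) {ψ : ℝ → ℝ} (hψ : IsTestFunction 0 T ψ) :
    -(∫ t in Ioo 0 T, stateCoeff T y₀ yT n t * deriv ψ t) +
      eigenvalue n * (∫ t in Ioo 0 T, stateCoeff T y₀ yT n t * ψ t) =
    gain T n * modalGap T y₀ yT n * ∫ t in Ioo 0 T, Real.exp (-eigenvalue n * (T - t)) * ψ t := by
  have hy := continuous_stateCoeff (T := T) (y₀ := y₀) (yT := yT) n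
  have hψc := hψ.1.continuous
  simp_rw [setIntegral_Ioo_eq_intervalIntegral hT]
  rw [intervalIntegral.integral_mul_deriv_eq_deriv_mul
    (fun t _ => hasDerivAt_stateCoeff hT n t)
    (fun t _ => (hψ.1.differentiable (by simp) t).hasDerivAt)
    (Continuous.intervalIntegrable (by fun_prop) _ _)
    (hψ.continuous_deriv.intervalIntegrable _ _), hψ.eq_zero_left, hψ.eq_zero_right]
  simp_rw [add_mul, mul_assoc]
  rw [intervalIntegral.integral_add (Continuous.intervalIntegrable (by fun_prop) _ _)
    (Continuous.intervalIntegrable (by fun_prop) _ _)]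
  simp only [intervalIntegral.integral_const_mul]
  ring

theorem integral_abs_stateCoeff_le (hT : 0 < T) (n : ℕ+) :
    ∫ t in Ioo 0 T, |stateCoeff T y₀ yT n t| ≤
      (eigenvalue n)⁻¹ * |fourierSineCoeff y₀ n| + T * |modalGap T y₀ yT n| := by
  have hc : Continuous fun t : ℝ => Real.exp (-eigenvalue n * t) * |fourierSineCoeff y₀ n| := by
    fun_prop
  have hle : ∫ t in Ioo 0 T, |stateCoeff T y₀ yT n t| ≤
      ∫ t in Ioo 0 T, (Real.exp (-eigenvalue n * t) * |fourierSineCoeff y₀ n|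
        + |modalGap T y₀ yT n|) :=
    setIntegral_mono_on (integrableOn_Ioo_of_continuous (continuous_stateCoeff n).abs)
      (integrableOn_Ioo_of_continuous (hc.add continuous_const)) measurableSet_Ioo
      fun t ht => abs_stateCoeff_le hT n (Ioo_subset_Icc_self ht)
  refine hle.trans ?_
  rw [integral_add (integrableOn_Ioo_of_continuous hc)
    (integrableOn_Ioo_of_continuous continuous_const), integral_mul_const]
  gcongr ?_ * _ + ?_
  · exact integral_exp_le (eigenvalue_pos n) hT
  · simp [hT.le]

/-- Termwise integration of series of modes against a bounded weight. -/
theorem hasSum_integral_stateCoeff (hT : 0 < T) {β : ℕ+ → ℝ}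
    (hβ : Summable fun n => |β n| *
      ((eigenvalue n)⁻¹ * |fourierSineCoeff y₀ n| + T * |modalGap T y₀ yT n|))
    {S : ℝ → ℝ} (hS : ∀ t ∈ Ioo 0 T, HasSum (fun n => stateCoeff T y₀ yT n t * β n) (S t))
    {g : ℝ → ℝ} (hg : Continuous g) :
    HasSum (fun n => β n * ∫ t in Ioo 0 T, stateCoeff T y₀ yT n t * g t)
      (∫ t in Ioo 0 T, S t * g t) := by
  obtain ⟨B, hB⟩ := (isCompact_Icc (a := (0 : ℝ)) (b := T)).exists_bound_of_continuousOn
    hg.continuousOn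
  have hB0 : 0 ≤ B := (norm_nonneg _).trans (hB 0 ⟨le_rfl, hT.le⟩)
  have hc : ∀ n, Continuous fun t => stateCoeff T y₀ yT n t * β n * g t := fun n =>
    ((continuous_stateCoeff n).mul continuous_const).mul hg
  have := hasSum_integral_of_summable_integral_norm (μ := volume.restrict (Ioo 0 T))
    (F := fun n t => stateCoeff T y₀ yT n t * β n * g t)
    (fun n => integrableOn_Ioo_of_continuous (hc n)) ?_
  · have e1 : ∀ n, ∫ t in Ioo 0 T, stateCoeff T y₀ yT n t * β n * g t =
        β n * ∫ t in Ioo 0 T, stateCoeff T y₀ yT n t * g t := fun n => by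
      rw [← integral_const_mul]; congr 1; ext t; ring
    have e2 : ∫ t in Ioo 0 T, ∑' n, stateCoeff T y₀ yT n t * β n * g t =
        ∫ t in Ioo 0 T, S t * g t :=
      setIntegral_congr_fun measurableSet_Ioo fun t ht => ((hS t ht).mul_right (g t)).tsum_eq
    rw [e2] at this
    simpa only [e1] using this
  · refine .of_nonneg_of_le (fun n => integral_nonneg fun t => norm_nonneg _) (fun n => ?_)
      (hβ.mul_left B)
    calc ∫ t in Ioo 0 T, ‖stateCoeff T y₀ yT n t * β n * g t‖
        ≤ ∫ t in Ioo 0 T, |stateCoeff T y₀ yT n t| * (|β n| * B) := by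
          refine setIntegral_mono_on (integrableOn_Ioo_of_continuous (hc n).norm)
            (integrableOn_Ioo_of_continuous ((continuous_stateCoeff n).abs.mul continuous_const))
            measurableSet_Ioo fun t ht => ?_
          rw [norm_mul, norm_mul, mul_assoc]
          exact mul_le_mul_of_nonneg_left (mul_le_mul_of_nonneg_left
            (hB t (Ioo_subset_Icc_self ht)) (norm_nonneg _)) (norm_nonneg _)
      _ = B * (|β n| * ∫ t in Ioo 0 T, |stateCoeff T y₀ yT n t|) := by
          rw [integral_mul_const]; ring
      _ ≤ _ := by gcongr; exact integral_abs_stateCoeff_le hT n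

theorem memLp_tensor (f : L2Space) {ψ : ℝ → ℝ} (hψ : IsTestFunction 0 T ψ) :
    MemLp (fun p : ℝ × ℝ => f p.1 * ψ p.2) 2 (cylinderMeasure T) := by
  obtain ⟨C, hC⟩ := hψ.2.1.exists_bound_of_continuous hψ.1.continuous
  rw [cylinderMeasure_eq_prod]
  have h1 := (Lp.memLp f).comp_fst (volume.restrict (Ioo 0 T))
  refine (h1.norm.const_mul C).mono'
    (h1.1.mul (hψ.1.continuous.comp continuous_snd).aestronglyMeasurable)
    (.of_forall fun p => ?_)
  rw [norm_mul, mul_comm]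
  gcongr
  exact hC p.2

theorem inner_controlModeL2_tensor (n : ℕ+) (f : L2Space) {ψ : ℝ → ℝ}
    (hψ : IsTestFunction 0 T ψ) :
    inner ℝ (controlModeL2 T y₀ yT n) ((memLp_tensor f hψ).toLp _) =
      fourierSineCoeff f n * (gain T n * modalGap T y₀ yT n *
        ∫ t in Ioo 0 T, Real.exp (-eigenvalue n * (T - t)) * ψ t) := by
  rw [controlModeL2, inner_toLp_toLp]
  have e : ∀ p : ℝ × ℝ, controlMode T y₀ yT n p * (f p.1 * ψ p.2) =
      (gain T n * modalGap T y₀ yT n) * ((f p.1 * eigenfunction n p.1) *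
        (Real.exp (-eigenvalue n * (T - p.2)) * ψ p.2)) := fun p => by
    rw [controlMode_eq, adjointMode]; ring
  simp_rw [e]
  rw [integral_const_mul, cylinderMeasure_eq_prod,
    integral_prod_mul (fun x => f x * eigenfunction n x)
      (fun t => Real.exp (-eigenvalue n * (T - t)) * ψ t), fourierSineCoeff]
  ring

/-- The three integrals of the weak equation are expanded in the modal coefficients of `v`; the
terms agree by `stateCoeff_weak`, and uniqueness of sums concludes. -/
theorem isWeakSolution_state (hT : 0 < T) (h : yT ∈ admissibleTargets T y₀) {u : L2Q T}
    (hu : HasSum (controlModeL2 T y₀ yT) u) : IsWeakSolution T u y₀ (state T y₀ yT) := by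
  refine ⟨continuousOn_state hT h, state_zero, stateDeriv T y₀ yT, memLp_state_pair hT h, ?_, ?_⟩
  · filter_upwards [ae_restrict_mem measurableSet_Ioo] with t ht
    exact state_mem_H01 hT h ht
  intro v hv ψ hψ
  set α : ℕ+ → ℝ := fourierSineCoeff v.1 with hα
  have hα1 : ∀ n, inner ℝ (sineL2 n) v.1 = α n := fun n => by
    rw [hα, fourierSineCoeff_eq_inner, real_inner_comm]
  have hα2 : ∀ n : ℕ+, inner ℝ (cosineL2 n) v.2 = n * Real.pi * α n := fun n => by
    rw [hα, real_inner_comm, inner_cosineL2_of_mem_H01 hv, fourierSineCoeff_eq_inner]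
  have sα : Summable fun n => α n ^ 2 := summable_fourierSineCoeff_sq v.1
  have sα' : Summable fun n : ℕ+ => (n * Real.pi * α n) ^ 2 := by
    refine (orthonormal_cosineL2.inner_products_summable v.2).congr fun n => ?_
    rw [hα2, Real.norm_eq_abs, sq_abs]
  have sd : Summable fun n : ℕ+ => (n * Real.pi * modalGap T y₀ yT n) ^ 2 := by
    refine (summable_eigenvalue_mul_modalGap_sq hT h).congr fun n => ?_
    rw [mul_pow, eigenvalue]
  -- In the `y₀` part `λ_n` cancels `λ_n⁻¹`. In the gap part it splits as `nπ · nπ`, one factor for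
  -- the coefficients of `v'` and one for the admissible gaps; both products are then summable.
  have s2 : Summable fun n => |eigenvalue n * α n| *
      ((eigenvalue n)⁻¹ * |fourierSineCoeff y₀ n| + T * |modalGap T y₀ yT n|) := by
    refine ((summable_mul_of_sq sα (summable_fourierSineCoeff_sq y₀)).add
      ((summable_mul_of_sq sα' sd).mul_left T)).congr fun n => ?_
    have hl := eigenvalue_pos n
    have hn : (0 : ℝ) ≤ n * Real.pi := by positivity
    have e : (n * Real.pi) * (n * Real.pi) = eigenvalue n := by rw [eigenvalue, sq]
    rw [abs_mul (n * Real.pi) (α n), abs_mul (n * Real.pi) (modalGap T y₀ yT n),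
      abs_mul (eigenvalue n), abs_of_pos hl, abs_of_nonneg hn, mul_add]
    field_simp
    linear_combination T * |α n| * |modalGap T y₀ yT n| * e
  have s1 : Summable fun n => |α n| *
      ((eigenvalue n)⁻¹ * |fourierSineCoeff y₀ n| + T * |modalGap T y₀ yT n|) := by
    refine .of_nonneg_of_le (fun n => ?_) (fun n => ?_) s2
    · have := eigenvalue_pos n; positivity
    · have := eigenvalue_pos n
      refine mul_le_mul_of_nonneg_right ?_ (by positivity)
      rw [abs_mul, abs_of_pos this]
      exact le_mul_of_one_le_left (abs_nonneg _) (one_le_eigenvalue n)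
  have H1 := hasSum_integral_stateCoeff hT s1 (S := fun t => inner ℝ (state T y₀ yT t) v.1)
    (fun t ht => by
      have := (hasSum_state hT h (Ioo_subset_Icc_self ht)).mapL ((innerSL ℝ).flip v.1)
      simpa only [ContinuousLinearMap.flip_apply, innerSL_apply_apply, inner_smul_left, hα1,
        conj_trivial] using this) hψ.continuous_deriv
  have H2 := hasSum_integral_stateCoeff hT s2 (S := fun t => inner ℝ (stateDeriv T y₀ yT t) v.2)
    (fun t ht => by
      have := (hasSum_stateDeriv hT h ht).mapL ((innerSL ℝ).flip v.2)
      simp only [ContinuousLinearMap.flip_apply, innerSL_apply_apply, inner_smul_left, hα2,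
        conj_trivial] at this
      refine this.congr_fun fun n => ?_
      rw [eigenvalue]; ring) hψ.1.continuous
  have H3 := hu.mapL ((innerSL ℝ).flip ((memLp_tensor v.1 hψ).toLp _))
  simp only [ContinuousLinearMap.flip_apply, innerSL_apply_apply] at H3
  rw [inner_toLp_right] at H3
  simp_rw [mul_assoc (u _)]
  refine (H1.neg.add H2).unique ?_
  convert H3 using 1
  ext n
  rw [inner_controlModeL2_tensor n v.1 hψ, ← stateCoeff_weak hT n hψ]
  ring

/-! ### Steering and orthogonality of the minimizer. -/

theorem steers_of_hasSum (hT : 0 < T) (h : yT ∈ admissibleTargets T y₀) {u : L2Q T}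
    (hu : HasSum (controlModeL2 T y₀ yT) u) : Steers T y₀ yT u :=
  ⟨state T y₀ yT, isWeakSolution_state hT h hu, state_terminal hT⟩

/-- All steering controls have the same inner product with the synthesized control. -/
theorem Steers.inner_eq_of_hasSum (hT : 0 < T) {u w : L2Q T}
    (hu : HasSum (controlModeL2 T y₀ yT) u) (hw : Steers T y₀ yT w) :
    HasSum (fun n => gain T n * modalGap T y₀ yT n * modalGap T y₀ yT n) (inner ℝ u w) := by
  have := hu.mapL ((innerSL ℝ).flip w)
  simp only [ContinuousLinearMap.flip_apply, innerSL_apply_apply, controlModeL2_eq,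
    inner_smul_left, conj_trivial] at this
  refine this.congr_fun fun n => ?_
  rw [hw.modalGap_eq_inner hT, real_inner_comm]

/-- Pythagoras: `⟨u, w⟩` and `⟨u, u⟩` are sums of the same series, because `u` is itself a steering
control. -/
theorem norm_sq_eq_of_steers (hT : 0 < T) {u w : L2Q T} (h : yT ∈ admissibleTargets T y₀)
    (hu : HasSum (controlModeL2 T y₀ yT) u) (hw : Steers T y₀ yT w) :
    ‖w‖ ^ 2 = ‖u‖ ^ 2 + ‖w - u‖ ^ 2 := by
  have h1 : inner ℝ u w = inner ℝ u u :=
    (hw.inner_eq_of_hasSum hT hu).unique ((steers_of_hasSum hT h hu).inner_eq_of_hasSum hT hu)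
  rw [norm_sub_sq_real, real_inner_comm, h1, real_inner_self_eq_norm_sq]
  ring

end

end HeatControl

theorem theorem3p2 (T : ℝ) (hT : 0 < T) (y₀ yT : L2Space)
    (hyT : yT ∈ admissibleTargets T y₀) :
    ∃ uStar : L2Q T,
      IsMinimumEnergyControl T y₀ yT uStar ∧
      (∀ w : L2Q T, IsMinimumEnergyControl T y₀ yT w → w = uStar) ∧
      HasSum (controlModeL2 T y₀ yT) uStar ∧
      ∀ᵐ p ∂(cylinderMeasure T), HasSum (fun n : ℕ+ => controlMode T y₀ yT n p) (uStar p) := by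
  have hu := (summable_controlModeL2 hT hyT).hasSum
  have hsteer := steers_of_hasSum hT hyT hu
  refine ⟨_, ⟨hsteer, fun w hw => ?_⟩, fun w hw => ?_, hu, ae_hasSum_controlMode hT hyT hu⟩
  · have := norm_sq_eq_of_steers hT hyT hu hw
    unfold energy
    nlinarith [sq_nonneg ‖w - ∑' n, controlModeL2 T y₀ yT n‖]
  · have h1 := norm_sq_eq_of_steers hT hyT hu hw.1
    have h2 := hw.2 _ hsteer
    unfold energy at h2
    have h3 : ‖w - ∑' n, controlModeL2 T y₀ yT n‖ ^ 2 = 0 :=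
      le_antisymm (by linarith) (sq_nonneg _)
    exact sub_eq_zero.1 (norm_eq_zero.1 (pow_eq_zero_iff two_ne_zero |>.1 h3))
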